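/- Let $E$ be a finite-dimensional real vector space. A polytope in $E$ is the convex hull of a non-empty finite subset of $E$; its dimension is that of its affine hull. A face of a polytope $M$ is a convex subset $F\subseteq M$ such that $x,y\in F$ whenever $x,y\in M$ and $tx+(1-t)y\in F$ for some $t\in\,]0,1[$; non-empty faces are again polytopes, and a $d$-face is a non-empty face of dimension $d$. An $n$-dimensional polytope $M$ (an $n$-polytope) is simple if, for all $k\in\{0,\ldots,n-1\}$, each $k$-face of $M$ is contained in exactly $n-k$ faces of dimension $n-1$. For a polytope $M\subseteq E$, let $E_M:=\mathrm{aff}(M)-x$ for any $x\in M$. Let $C^\infty(M,E)$ be the space of smooth functions $f\colon M\to E$, where $M$ is considered as a convex subset with dense interior of the affine space $\mathrm{aff}(M)$, endowed with the compact-open $C^\infty$-topology, i.e. the initial topology with respect to the maps $f\mapsto d^kf$ to $C(M\times E_M^k,E)$ for $k\in\mathbb{N}_0$, where $d^kf(x,y_1,\ldots,y_k)$ is the $k$-th derivative of $f$ at $x$ in the directions $y_1,\ldots,y_k$ and $C(M\times E_M^k,E)$ carries the compact-open topology. For $x\in M$, let $M(x)$ be the smallest face of $M$ containing $x$, and $E_x:=E_{M(x)}=\mathrm{aff}(M(x))-x$.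 Let \[ C^\infty_{\mathrm{str}}(M,E):=\{f\in C^\infty(M,E)\colon f(x)\in E_x \text{ for all } x\in M\} \] be the space of stratified vector fields on $M$, with the topology induced by $C^\infty(M,E)$. Let $n$ be a positive integer, $M\subseteq E$ a simple $n$-polytope, $\ell\in\{1,\ldots,n-1\}$, and $\mathcal F$ the set of all $\ell$-faces of $M$. Let $\mathcal V$ be the vector subspace of $\prod_{F\in\mathcal F}C^\infty_{\mathrm{str}}(F,E)$ (with the product topology) consisting of all $(f_F)_{F\in\mathcal F}$ such that $f_F|_{F\cap G}=f_G|_{F\cap G}$ for all $F,G\in\mathcal F$. Then $\mathcal V$ is closed, and the map \[ R\colon C^\infty_{\mathrm{str}}(M,E)\to\mathcal V,\qquad f\mapsto (f|_F)_{F\in\mathcal F} \] is continuous and linear and has a continuous linear right inverse $\tau\colon\mathcal V\to C^\infty_{\mathrm{str}}(M,E)$. -/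

import Mathlib

open scoped ContDiff Pointwise

/-- A polytope in `E`: the convex hull of a non-empty finite subset of `E`. -/
structure Polytope (E : Type*) [NormedAddCommGroup E] [NormedSpace ℝ E] where
  carrier : Set E
  exists_finset : ∃ s : Finset E, s.Nonempty ∧ carrier = convexHull ℝ (s : Set E)

/-- `F` is a face of the set `M`: a convex subset of `M` such that any `x, y ∈ M` for which
some point `t x + (1 - t) y` with `0 < t < 1` is in `F` are both in `F`. -/
def IsFace {E : Type*} [NormedAddCommGroup E] [NormedSpace ℝ E] (M F : Set E) : Prop :=
  IsExtreme ℝ M F ∧ Convex ℝ F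

namespace Polytope

section

variable {E : Type*} [NormedAddCommGroup E] [NormedSpace ℝ E]

theorem convex (M : Polytope E) : Convex ℝ M.carrier := by
  obtain ⟨s, -, hs⟩ := M.exists_finset
  rw [hs]
  exact convex_convexHull ℝ _

theorem nonempty (M : Polytope E) : M.carrier.Nonempty := by
  obtain ⟨s, hs, h⟩ := M.exists_finset
  rw [h]
  exact (Finset.coe_nonempty.2 hs).convexHull

/-- Each non-empty face of a polytope is a polytope. Hence nothing is lost by quantifying over
those faces of `M` that are given as terms of type `Polytope E`. -/
theorem exists_carrier_eq_of_isFace (M : Polytope E) {F : Set E} (hF : IsFace M.carrier F)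
    (hne : F.Nonempty) : ∃ N : Polytope E, N.carrier = F := by
  classical
  obtain ⟨s, -, hs⟩ := M.exists_finset
  obtain ⟨hext, hconv⟩ := hF
  set A : Set E := (s : Set E) ∩ F with hA
  set B : Set E := (s : Set E) \ F with hB
  have hsub : (s : Set E) ⊆ M.carrier := hs ▸ subset_convexHull ℝ _
  have hAF : convexHull ℝ A ⊆ F := convexHull_min Set.inter_subset_right hconv
  have hBF : convexHull ℝ B ⊆ M.carrier \ F :=
    convexHull_min (fun y hy => ⟨hsub hy.1, hy.2⟩) (hext.convex_sdiff M.convex)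
  have key : F = convexHull ℝ A := by
    refine Set.Subset.antisymm (fun x hx => ?_) hAF
    have hxM : x ∈ convexHull ℝ (A ∪ B) := by
      rw [hA, hB, Set.inter_union_sdiff, ← hs]
      exact hext.subset hx
    rcases Set.eq_empty_or_nonempty B with hB0 | hBne
    · rwa [hB0, Set.union_empty] at hxM
    rcases Set.eq_empty_or_nonempty A with hA0 | hAne
    · rw [hA0, Set.empty_union] at hxM
      exact absurd hx (hBF hxM).2
    rw [convexHull_union hAne hBne, mem_convexJoin] at hxM
    obtain ⟨a, ha, b, hb, hab⟩ := hxM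
    rw [← insert_endpoints_openSegment] at hab
    rcases hab with rfl | rfl | hab
    · exact ha
    · exact absurd hx (hBF hb).2
    · exact absurd (hext.right_mem_of_mem_openSegment (hext.subset (hAF ha)) (hBF hb).1 hx hab)
        (hBF hb).2
  refine ⟨⟨F, s.filter (· ∈ F), ?_, ?_⟩, rfl⟩
  · have : (convexHull ℝ A).Nonempty := key ▸ hne
    obtain ⟨y, hy⟩ := convexHull_nonempty_iff.1 this
    exact ⟨y, by simpa [hA] using hy⟩
  · rw [key, ← key, Finset.coe_filter]
    exact key

/-- The vector subspace `E_M = aff(M) - x` (for any `x ∈ M`) of `E`. -/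
abbrev dirSpace (M : Polytope E) : Submodule ℝ E := vectorSpan ℝ M.carrier

/-- The dimension of a polytope, i.e. the dimension of its affine hull. -/
noncomputable def dim (M : Polytope E) : ℕ := Module.finrank ℝ M.dirSpace

/-- `M` is simple: for all `k < dim M`, each `k`-face of `M` is contained in exactly
`dim M - k` facets, that is, faces of dimension `dim M - 1`. -/
def IsSimple (M : Polytope E) : Prop :=
  ∀ F : Polytope E, IsFace M.carrier F.carrier → F.dim < M.dim →
    {G : Polytope E | IsFace M.carrier G.carrier ∧ G.dim + 1 = M.dim ∧
      F.carrier ⊆ G.carrier}.encard = ((M.dim - F.dim : ℕ) : ℕ∞)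

/-- The `l`-faces of `M`. -/
def Face (M : Polytope E) (l : ℕ) : Type _ :=
  {F : Polytope E // IsFace M.carrier F.carrier ∧ F.dim = l}

/-- The smallest face `M(x)` of `M` containing `x`. -/
def minFace (M : Polytope E) (x : E) : Set E :=
  ⋂₀ {F : Set E | IsFace M.carrier F ∧ x ∈ F}

/-- The vector subspace `E_x = aff(M(x)) - x` of `E`. -/
def strataSpace (M : Polytope E) (x : E) : Submodule ℝ E := vectorSpan ℝ (M.minFace x)

/-- The translate `M - x`, as a subset of `E_M` (for `x ∈ M`). -/
def transSet (M : Polytope E) (x : M.carrier) : Set M.dirSpace :=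
  {v | (x : E) + (v : E) ∈ M.carrier}

/-- The function `v ↦ f (x + v)` on `M - x ⊆ E_M`, extended by `0` to all of `E_M`. -/
noncomputable def transFun (M : Polytope E) {Y : Type*} [NormedAddCommGroup Y] (f : M.carrier → Y)
    (x : M.carrier) : M.dirSpace → Y :=
  fun v => Function.extend Subtype.val f 0 ((x : E) + (v : E))

theorem transFun_of_mem (M : Polytope E) {Y : Type*} [NormedAddCommGroup Y] (f : M.carrier → Y) (x : M.carrier) {v : M.dirSpace}
    (hv : v ∈ M.transSet x) : M.transFun f x v = f ⟨(x : E) + (v : E), hv⟩ :=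
  Subtype.val_injective.extend_apply f 0 ⟨_, hv⟩

variable {Y : Type*} [NormedAddCommGroup Y] [NormedSpace ℝ Y]

/-- `f : M → Y` is smooth. The polytope `M` is identified with the convex subset `M - x` of the
vector space `E_M`, which has dense interior. -/
def IsSmooth (M : Polytope E) (f : M.carrier → Y) : Prop :=
  ∀ x : M.carrier, ContDiffOn ℝ ∞ (M.transFun f x) (M.transSet x)

variable (Y) in
/-- The vector space `C^∞(M, Y)` of smooth functions on `M`, with pointwise operations. -/
def smoothSubmodule (M : Polytope E) : Submodule ℝ (M.carrier → Y) where
  carrier := {f | M.IsSmooth f}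
  zero_mem' := fun x => contDiffOn_const (c := (0 : Y)) |>.congr fun v hv => by
    rw [transFun_of_mem M _ x hv]; rfl
  add_mem' := fun {f g} hf hg x => ((hf x).add (hg x)).congr fun v hv => by
    simp only [transFun_of_mem M _ x hv]; rfl
  smul_mem' := fun c f hf x => ((hf x).const_smul c).congr fun v hv => by
    simp only [transFun_of_mem M _ x hv]; rfl

variable (Y) in
/-- The space `C^∞(M, Y)`. (This is a type of its own, as its topology is not that of pointwise
convergence.) -/
def SmoothMap (M : Polytope E) : Type _ := M.smoothSubmodule Y

noncomputable instance (M : Polytope E) : AddCommGroup (M.SmoothMap Y) :=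
  inferInstanceAs (AddCommGroup (M.smoothSubmodule Y))

noncomputable instance (M : Polytope E) : Module ℝ (M.SmoothMap Y) :=
  inferInstanceAs (Module ℝ (M.smoothSubmodule Y))

instance (M : Polytope E) : CoeFun (M.SmoothMap Y) (fun _ => M.carrier → Y) :=
  ⟨fun f => f.1⟩

theorem SmoothMap.isSmooth {M : Polytope E} (f : M.SmoothMap Y) : M.IsSmooth f := f.2

theorem convex_transSet (M : Polytope E) (x : M.carrier) : Convex ℝ (M.transSet x) := by
  intro v hv w hw a b ha hb hab
  have h := M.convex hv hw ha hb hab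
  have e : (x : E) + ((a • v + b • w : M.dirSpace) : E)
      = a • ((x : E) + (v : E)) + b • ((x : E) + (w : E)) := by
    have hx : (x : E) = (a + b) • (x : E) := by rw [hab, one_smul]
    conv_lhs => rw [hx]
    push_cast
    module
  change (x : E) + ((a • v + b • w : M.dirSpace) : E) ∈ M.carrier
  rw [e]
  exact h

theorem interior_transSet_nonempty [FiniteDimensional ℝ E] (M : Polytope E) (x : M.carrier) :
    (interior (M.transSet x)).Nonempty := by
  rw [(M.convex_transSet x).interior_nonempty_iff_affineSpan_eq_top]
  have h0 : (0 : M.dirSpace) ∈ M.transSet x := by simp [transSet]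
  have himg : (M.dirSpace.subtype '' (M.transSet x)) = (fun y => y -ᵥ (x : E)) '' M.carrier := by
    ext y
    constructor
    · rintro ⟨v, hv, rfl⟩
      exact ⟨_, hv, by simp⟩
    · rintro ⟨z, hz, rfl⟩
      exact ⟨⟨z -ᵥ (x : E), vsub_mem_vectorSpan ℝ hz x.2⟩, by simpa [transSet] using hz, rfl⟩
  have hspan : Submodule.span ℝ (M.transSet x) = ⊤ := by
    apply Submodule.map_injective_of_injective M.dirSpace.injective_subtype
    rw [Submodule.map_span, himg, ← vectorSpan_eq_span_vsub_set_right ℝ x.2, Submodule.map_top,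
      Submodule.range_subtype]
  rw [AffineSubspace.affineSpan_eq_top_iff_vectorSpan_eq_top_of_nonempty ℝ _ _ ⟨0, h0⟩,
    vectorSpan_eq_span_vsub_set_right ℝ h0]
  simpa using hspan

theorem uniqueDiffOn_transSet [FiniteDimensional ℝ E] (M : Polytope E) (x : M.carrier) :
    UniqueDiffOn ℝ (M.transSet x) :=
  uniqueDiffOn_convex (M.convex_transSet x) (M.interior_transSet_nonempty x)

/-- The `k`-th derivative `d^k f (x, y₁, …, y_k)` of `f : M → Y`, for `x ∈ M` and directions
`y₁, …, y_k ∈ E_M`. -/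
noncomputable def iterDeriv (M : Polytope E) (f : M.carrier → Y) (k : ℕ)
    (p : M.carrier × (Fin k → M.dirSpace)) : Y :=
  iteratedFDerivWithin ℝ k (M.transFun f p.1) (M.transSet p.1) 0 p.2

theorem iterDeriv_eq (M : Polytope E) (f : M.carrier → Y) (k : ℕ) (x₀ : M.carrier)
    (p : M.carrier × (Fin k → M.dirSpace)) :
    M.iterDeriv f k p = iteratedFDerivWithin ℝ k (M.transFun f x₀) (M.transSet x₀)
      ⟨(p.1 : E) - (x₀ : E), vsub_mem_vectorSpan ℝ p.1.2 x₀.2⟩ p.2 := by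
  set w : M.dirSpace := ⟨(p.1 : E) - (x₀ : E), vsub_mem_vectorSpan ℝ p.1.2 x₀.2⟩ with hw
  have h1 : M.transFun f p.1 = fun v => M.transFun f x₀ (w + v) := by
    funext v
    simp only [transFun]
    congr 1
    simp [hw, ← add_assoc]
  have h2 : M.transSet x₀ = w +ᵥ M.transSet p.1 := by
    ext v
    rw [Set.mem_vadd_set_iff_neg_vadd_mem]
    have : (p.1 : E) + ((-w +ᵥ v : M.dirSpace) : E) = (x₀ : E) + (v : E) := by
      simp only [hw, vadd_eq_add, Submodule.coe_add, Submodule.coe_neg]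
      abel
    change (x₀ : E) + (v : E) ∈ M.carrier ↔
      (p.1 : E) + ((-w +ᵥ v : M.dirSpace) : E) ∈ M.carrier
    rw [this]
  rw [iterDeriv, h1, iteratedFDerivWithin_comp_add_left, ← h2, add_zero]

theorem continuous_iterDeriv [FiniteDimensional ℝ E] (M : Polytope E) {f : M.carrier → Y}
    (hf : M.IsSmooth f) (k : ℕ) : Continuous (M.iterDeriv f k) := by
  obtain ⟨y, hy⟩ := M.nonempty
  set x₀ : M.carrier := ⟨y, hy⟩
  have h : ContinuousOn (iteratedFDerivWithin ℝ k (M.transFun f x₀) (M.transSet x₀))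
      (M.transSet x₀) :=
    (hf x₀).continuousOn_iteratedFDerivWithin (by exact_mod_cast le_top)
      (M.uniqueDiffOn_transSet x₀)
  have h' : Continuous fun p : M.carrier × (Fin k → M.dirSpace) =>
      iteratedFDerivWithin ℝ k (M.transFun f x₀) (M.transSet x₀)
        ⟨(p.1 : E) - (x₀ : E), vsub_mem_vectorSpan ℝ p.1.2 x₀.2⟩ := by
    refine h.comp_continuous ?_ fun p => ?_
    · exact Continuous.subtype_mk (by fun_prop) _
    · simp [transSet]
  rw [funext (M.iterDeriv_eq f k x₀)]
  exact h'.eval continuous_snd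

/-- The continuous function `d^k f : M × E_M^k → Y` for `f ∈ C^∞(M, Y)`. -/
noncomputable def iterDerivMap [FiniteDimensional ℝ E] (M : Polytope E) (k : ℕ)
    (f : M.SmoothMap Y) : C(M.carrier × (Fin k → M.dirSpace), Y) :=
  ⟨M.iterDeriv f k, M.continuous_iterDeriv f.isSmooth k⟩

/-- The compact-open `C^∞`-topology on `C^∞(M, Y)`: the initial topology with respect to the maps
`f ↦ d^k f` to `C(M × E_M^k, Y)`, for all `k ≥ 0`, where the latter space carries the
compact-open topology. -/
noncomputable instance [FiniteDimensional ℝ E] (M : Polytope E) :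
    TopologicalSpace (M.SmoothMap Y) :=
  ⨅ k : ℕ, TopologicalSpace.induced (M.iterDerivMap k) inferInstance

/-- The space `C^∞_str(M, E)` of stratified vector fields on `M`: the smooth functions
`f : M → E` with `f x ∈ E_x` for all `x ∈ M`. As a subspace, it carries the topology induced by
`C^∞(M, E)`. -/
def stratFields (M : Polytope E) : Submodule ℝ (M.SmoothMap E) where
  carrier := {f | ∀ x : M.carrier, f x ∈ M.strataSpace x}
  zero_mem' := fun _ => Submodule.zero_mem _
  add_mem' := fun hf hg x => Submodule.add_mem _ (hf x) (hg x)
  smul_mem' := fun c _ hf x => Submodule.smul_mem _ c (hf x)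

/-- The space of compatible families of stratified vector fields on the `l`-faces of `M`, as a
subspace of the direct product of the spaces `C^∞_str(F, E)`. -/
def compatFields [FiniteDimensional ℝ E] (M : Polytope E) (l : ℕ) :
    Submodule ℝ ((F : M.Face l) → F.1.stratFields) where
  carrier := {f | ∀ (F G : M.Face l) (x : E) (hF : x ∈ F.1.carrier) (hG : x ∈ G.1.carrier),
    (f F).1 ⟨x, hF⟩ = (f G).1 ⟨x, hG⟩}
  zero_mem' := fun _ _ _ _ _ => rfl
  add_mem' := fun hf hg F G x hF hG => congrArg₂ (· + ·) (hf F G x hF hG) (hg F G x hF hG)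
  smul_mem' := fun c _ hf F G x hF hG => congrArg (c • ·) (hf F G x hF hG)

theorem Face.subset {M : Polytope E} {l : ℕ} (F : M.Face l) : F.1.carrier ⊆ M.carrier :=
  F.2.1.1.subset

theorem IsSmooth.restrict {M F : Polytope E} (h : F.carrier ⊆ M.carrier) {f : M.carrier → Y}
    (hf : M.IsSmooth f) : F.IsSmooth (f ∘ Set.inclusion h) := by
  intro x
  have hd : F.dirSpace ≤ M.dirSpace := vectorSpan_mono ℝ h
  let L : F.dirSpace →L[ℝ] M.dirSpace :=
    ⟨Submodule.inclusion hd, continuous_inclusion hd⟩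
  have hmaps : Set.MapsTo L (F.transSet x) (M.transSet (Set.inclusion h x)) :=
    fun v hv => h hv
  refine ((hf (Set.inclusion h x)).comp L.contDiff.contDiffOn hmaps).congr fun v hv => ?_
  exact (transFun_of_mem F _ x hv).trans (transFun_of_mem M f _ (hmaps hv)).symm

theorem strataSpace_mono {M F : Polytope E} (hF : IsFace M.carrier F.carrier) (x : E) :
    M.strataSpace x ≤ F.strataSpace x := by
  refine vectorSpan_mono ℝ (Set.sInter_subset_sInter ?_)
  rintro G ⟨hG, hx⟩
  exact ⟨⟨hF.1.trans hG.1, hG.2⟩, hx⟩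

/-- The restriction `f|_F` of a stratified vector field `f` on `M` to a face `F`. -/
def restrictStrat {M : Polytope E} {l : ℕ} (F : M.Face l) (f : M.stratFields) :
    F.1.stratFields :=
  ⟨⟨f.1 ∘ Set.inclusion F.subset, f.1.isSmooth.restrict F.subset⟩,
    fun x => strataSpace_mono F.2.1 x (f.2 (Set.inclusion F.subset x))⟩

/-- The restriction map `f ↦ (f|_F)_F` to the `l`-faces `F` of `M`. -/
def restrictFaces [FiniteDimensional ℝ E] (M : Polytope E) (l : ℕ) :
    M.stratFields →ₗ[ℝ] M.compatFields l where
  toFun f := ⟨fun F => restrictStrat F f, fun _ _ _ _ _ => rfl⟩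
  map_add' _ _ := rfl
  map_smul' _ _ := rfl

end

end Polytope

/-! Near a point `x` of a simple polytope `M`, the facet functions vanishing at `x` (the active
ones) have linearly independent linear parts on `E_M`, so `M` looks like a corner there. With dual
vectors `e a`, the projection `P_J y = y - ∑ a ∈ J, a y • e a` maps points of `M` near `x` into the
face on which all `a ∈ J` vanish. The `l`-faces meeting this neighbourhood are given by the sets in
`K`, the set of all `(n - l)`-element sets of active functions.

A compatible family `f` is extended near `x` by inclusion-exclusion: the sum of `(-1)^(|S|+1) • f
(P_{⋃S} y)` over all non-empty `S ⊆ K`. On the face given by `A ∈ K`, one has `P_{A ∪ J} = P_J`, so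
the terms for `S` and `S ∪ {A}` cancel for each non-empty `S` not containing `A`. What remains is `S
= {A}`, where `P_A` is the identity. The result is stratified: functions vanishing at `y` still
vanish at `P_J y`, whence `E_{P_J y} ⊆ E_y`. A smooth partition of unity glues the local extensions,
as multiplication by scalars respects both the strata and the restriction to faces.

Each summand uses `f` on one face only and has the form `φ • (f ∘ P)`. Leibniz and chain rule
estimates show that such operators are continuous; restriction to a face is the case `φ = 1`, `P =
id`. Closedness holds because point evaluations are continuous. The corner structure is obtained
from an irredundant system of inequalities for `M`, which Fourier-Motzkin elimination supplies, and
a count of the facets through a face (`surjective_linearParts`). -/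

namespace Polytope

/-! ### The `C^∞`-topology in terms of operator norms of derivatives -/

section Topology

variable {E : Type*} [NormedAddCommGroup E] [NormedSpace ℝ E]
theorem transFun_add {Y : Type*} [NormedAddCommGroup Y] (M : Polytope E)
    (f g : M.carrier → Y) (x : M.carrier) :
    M.transFun (f + g) x = M.transFun f x + M.transFun g x := by
  funext v
  by_cases hv : v ∈ M.transSet x
  · simp [transFun_of_mem M _ x hv]
  · have : ¬ ∃ a : M.carrier, (a : E) = (x : E) + (v : E) := by
      rintro ⟨a, ha⟩
      exact hv (by change (x : E) + (v : E) ∈ M.carrier; rw [← ha]; exact a.2)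
    simp [transFun, Function.extend_apply' _ _ _ this]

variable {Y : Type*} [NormedAddCommGroup Y] [NormedSpace ℝ Y]

theorem isCompact_carrier (M : Polytope E) : IsCompact M.carrier := by
  obtain ⟨s, -, hs⟩ := M.exists_finset
  rw [hs]
  exact s.finite_toSet.isCompact_convexHull ℝ

theorem isCompact_transSet (M : Polytope E) (x : M.carrier) : IsCompact (M.transSet x) := by
  have h : Topology.IsClosedEmbedding fun v : M.carrier =>
      (⟨(v : E) - (x : E), vsub_mem_vectorSpan ℝ v.2 x.2⟩ : M.dirSpace) := by
    have : CompactSpace M.carrier := isCompact_iff_compactSpace.1 M.isCompact_carrier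
    refine Continuous.isClosedEmbedding (by fun_prop) fun v w hvw => ?_
    simpa [Subtype.ext_iff] using hvw
  have : CompactSpace M.carrier := isCompact_iff_compactSpace.1 M.isCompact_carrier
  convert isCompact_range h.continuous
  ext v
  constructor
  · intro hv
    exact ⟨⟨_, hv⟩, by simp⟩
  · rintro ⟨w, rfl⟩
    simp [transSet]

/-- The `k`-th derivative of `f` at `x`, as a continuous multilinear map. -/
noncomputable def iterFDeriv (M : Polytope E) (f : M.carrier → Y) (k : ℕ) (x : M.carrier) :
    ContinuousMultilinearMap ℝ (fun _ : Fin k => M.dirSpace) Y :=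
  iteratedFDerivWithin ℝ k (M.transFun f x) (M.transSet x) 0

/-- Changing the base point is a translation, so the derivatives at all points can be computed from
one function on the single set `M - x₀`. -/
theorem iterFDeriv_eq (M : Polytope E) (f : M.carrier → Y) (k : ℕ) (x₀ x : M.carrier) :
    M.iterFDeriv f k x = iteratedFDerivWithin ℝ k (M.transFun f x₀) (M.transSet x₀)
      ⟨(x : E) - (x₀ : E), vsub_mem_vectorSpan ℝ x.2 x₀.2⟩ :=
  ContinuousMultilinearMap.ext fun m => M.iterDeriv_eq f k x₀ (x, m)

theorem zero_mem_transSet (M : Polytope E) (x : M.carrier) : (0 : M.dirSpace) ∈ M.transSet x := by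
  simp [transSet]

variable [FiniteDimensional ℝ E]

theorem iterFDeriv_add (M : Polytope E) {f g : M.carrier → Y} (hf : M.IsSmooth f)
    (hg : M.IsSmooth g) (k : ℕ) (x : M.carrier) :
    M.iterFDeriv (f + g) k x = M.iterFDeriv f k x + M.iterFDeriv g k x := by
  have hk : ((k : ℕ) : WithTop ℕ∞) ≤ ∞ := by exact_mod_cast le_top
  rw [iterFDeriv, transFun_add]
  exact iteratedFDerivWithin_add_apply ((hf x _ (M.zero_mem_transSet x)).of_le hk)
    ((hg x _ (M.zero_mem_transSet x)).of_le hk) (M.uniqueDiffOn_transSet x)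
    (M.zero_mem_transSet x)

variable (Y) in
/-- The map `f ↦ d^k f` as a homomorphism of additive groups. -/
noncomputable def iterDerivHom (M : Polytope E) (k : ℕ) :
    M.SmoothMap Y →+ C(M.carrier × (Fin k → M.dirSpace), Y) :=
  AddMonoidHom.mk' (M.iterDerivMap k) fun f g => by
    ext p
    exact congrArg (fun L => L p.2) (M.iterFDeriv_add f.isSmooth g.isSmooth k p.1)

instance (M : Polytope E) : IsTopologicalAddGroup (M.SmoothMap Y) :=
  topologicalAddGroup_iInf fun k => topologicalAddGroup_induced (M.iterDerivHom Y k)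

theorem continuous_iterDerivMap (M : Polytope E) (k : ℕ) :
    Continuous (M.iterDerivMap k : M.SmoothMap Y → _) :=
  continuous_iff_le_induced.2 (iInf_le _ k)

theorem SmoothMap.iterDeriv_zero_apply {M : Polytope E} (f : M.SmoothMap Y) (x : M.carrier)
    (v : Fin 0 → M.dirSpace) : M.iterDerivMap 0 f (x, v) = f x := by
  have h := transFun_of_mem M f x (M.zero_mem_transSet x)
  have e : (⟨(x : E) + ((0 : M.dirSpace) : E), M.zero_mem_transSet x⟩ : M.carrier) = x :=
    Subtype.ext (by simp)
  rw [e] at h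
  exact h

theorem SmoothMap.continuous_eval {M : Polytope E} (x : M.carrier) :
    Continuous fun f : M.SmoothMap Y => f x := by
  have : (fun f : M.SmoothMap Y => f x)
      = fun f => M.iterDerivMap 0 f (x, 0) := by
    funext f
    exact (f.iterDeriv_zero_apply x 0).symm
  rw [this]
  exact (ContinuousEvalConst.continuous_eval_const (F := C(_, Y)) _).comp
    (M.continuous_iterDerivMap 0)

theorem _root_.ContinuousMultilinearMap.norm_le_of_forall_norm_le_one {ι : Type*} [Fintype ι]
    {V W : Type*} [NormedAddCommGroup V] [NormedSpace ℝ V] [NormedAddCommGroup W]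
    [NormedSpace ℝ W] (L : ContinuousMultilinearMap ℝ (fun _ : ι => V) W) {C : ℝ} (hC : 0 ≤ C)
    (h : ∀ m : ι → V, (∀ i, ‖m i‖ ≤ 1) → ‖L m‖ ≤ C) : ‖L‖ ≤ C := by
  refine ContinuousMultilinearMap.opNorm_le_bound hC fun m => ?_
  -- This also holds where `m i = 0`, as both sides are then zero.
  have e : m = fun i => ‖m i‖ • (‖m i‖⁻¹ • m i) := by
    funext i
    by_cases hi : m i = 0
    · simp [hi]
    · rw [smul_smul, mul_inv_cancel₀ (norm_ne_zero_iff.2 hi), one_smul]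
  conv_lhs => rw [e]
  rw [ContinuousMultilinearMap.map_smul_univ, norm_smul, norm_prod, mul_comm]
  simp only [norm_norm]
  refine mul_le_mul_of_nonneg_right (h _ fun i => ?_) (by positivity)
  rw [norm_smul, norm_inv, norm_norm]
  exact inv_mul_le_one

/-- Compact-open convergence of `d^k f` is uniform on the compact product of `M` and unit balls, and
multilinearity turns this into an operator norm bound. -/
theorem SmoothMap.eventually_norm_iterFDeriv_le (M : Polytope E) (k : ℕ) {C : ℝ} (hC : 0 < C) :
    ∀ᶠ f : M.SmoothMap Y in nhds 0, ∀ x, ‖M.iterFDeriv f k x‖ ≤ C := by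
  have h := (M.continuous_iterDerivMap (Y := Y) k).tendsto 0
  rw [ContinuousMap.tendsto_iff_forall_isCompact_tendstoUniformlyOn] at h
  have : CompactSpace M.carrier := isCompact_iff_compactSpace.1 M.isCompact_carrier
  have h0 : M.iterDerivMap k (0 : M.SmoothMap Y) = 0 := map_zero (M.iterDerivHom Y k)
  have hK : IsCompact ((Set.univ : Set M.carrier) ×ˢ
      Set.pi (Set.univ : Set (Fin k)) fun _ => Metric.closedBall (0 : M.dirSpace) 1) :=
    isCompact_univ.prod (isCompact_univ_pi fun _ => isCompact_closedBall _ _)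
  filter_upwards [Metric.tendstoUniformlyOn_iff.1 (h _ hK) C hC] with f hf x
  refine ContinuousMultilinearMap.norm_le_of_forall_norm_le_one _ hC.le fun m hm => ?_
  have := hf (x, m) ⟨trivial, fun i _ => by simpa using hm i⟩
  rw [h0, ContinuousMap.zero_apply, dist_zero_left] at this
  exact this.le

theorem SmoothMap.tendsto_zero_of_eventually {X : Type*} {l : Filter X} (M : Polytope E)
    (T : X → M.SmoothMap Y)
    (h : ∀ (k : ℕ) (C : ℝ), 0 < C → ∀ᶠ f in l, ∀ x, ‖M.iterFDeriv (T f) k x‖ ≤ C) :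
    Filter.Tendsto T l (nhds 0) := by
  rw [nhds_iInf, Filter.tendsto_iInf]
  intro k
  rw [nhds_induced, Filter.tendsto_comap_iff]
  have h0 : M.iterDerivMap k (0 : M.SmoothMap Y) = 0 := map_zero (M.iterDerivHom Y k)
  rw [h0, ContinuousMap.tendsto_iff_forall_isCompact_tendstoUniformlyOn]
  intro K hK
  rw [Metric.tendstoUniformlyOn_iff]
  intro ε hε
  obtain ⟨R, hR⟩ := (hK.image continuous_snd).isBounded.exists_norm_le
  have hR0 : 0 ≤ |R| := abs_nonneg R
  filter_upwards [h k (ε / 2 / (|R| + 1) ^ k) (by positivity)] with f hf p hp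
  rw [ContinuousMap.zero_apply, dist_zero_left]
  have hp' : ∀ i, ‖p.2 i‖ ≤ |R| + 1 := fun i =>
    (norm_le_pi_norm p.2 i).trans ((hR _ ⟨p, hp, rfl⟩).trans (by linarith [le_abs_self R]))
  calc ‖M.iterFDeriv (T f) k p.1 p.2‖ ≤ ‖M.iterFDeriv (T f) k p.1‖ * ∏ i, ‖p.2 i‖ :=
        ContinuousMultilinearMap.le_opNorm _ _
    _ ≤ (ε / 2 / (|R| + 1) ^ k) * ∏ _i : Fin k, (|R| + 1) :=
        mul_le_mul (hf p.1) (Finset.prod_le_prod (fun _ _ => norm_nonneg _) fun i _ => hp' i)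
          (Finset.prod_nonneg fun _ _ => norm_nonneg _) (by positivity)
    _ = ε / 2 := by
        rw [Finset.prod_const, Finset.card_univ, Fintype.card_fin]
        field_simp
    _ < ε := by linarith

/-- The usual seminorm criterion: it suffices to bound each derivative of `T f` by finitely many
derivatives of `f`. -/
theorem SmoothMap.continuous_of_bound {M F : Polytope E} (T : F.SmoothMap Y →ₗ[ℝ] M.SmoothMap Y)
    (hT : ∀ k : ℕ, ∃ K : ℝ, 0 ≤ K ∧ ∀ (f : F.SmoothMap Y) (C : ℝ), 0 ≤ C →
      (∀ j ≤ k, ∀ y, ‖F.iterFDeriv f j y‖ ≤ C) → ∀ x, ‖M.iterFDeriv (T f) k x‖ ≤ K * C) :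
    Continuous T := by
  refine continuous_of_continuousAt_zero T ?_
  rw [ContinuousAt, map_zero]
  refine SmoothMap.tendsto_zero_of_eventually M T fun k C hC => ?_
  obtain ⟨K, hK, h⟩ := hT k
  -- Dividing by `K + 1` rather than `K` covers `K = 0`.
  have h1 : 0 < C / (K + 1) := by positivity
  have : ∀ᶠ f : F.SmoothMap Y in nhds 0, ∀ j ∈ Finset.range (k + 1), ∀ y,
      ‖F.iterFDeriv f j y‖ ≤ C / (K + 1) :=
    (Finset.eventually_all _).2 fun j _ => SmoothMap.eventually_norm_iterFDeriv_le F j h1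
  filter_upwards [this] with f hf x
  refine (h f _ h1.le (fun j hj y => hf j (by simpa [Nat.lt_succ_iff] using hj) y) x).trans ?_
  rw [mul_div_assoc', div_le_iff₀ (by positivity)]
  nlinarith

end Topology

end Polytope

namespace Polytope

/-! ### Continuity of the operators `f ↦ φ • (f ∘ P)` -/

section WeightedComp

variable {E : Type*} [NormedAddCommGroup E] [NormedSpace ℝ E]
theorem extend_zero_add {Y : Type*} [NormedAddCommGroup Y] (F : Polytope E)
    (f g : F.carrier → Y) (z : E) :
    Function.extend Subtype.val (f + g) 0 z =
      Function.extend Subtype.val f 0 z + Function.extend Subtype.val g 0 z := by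
  by_cases h : z ∈ F.carrier
  · have e : ∀ u : F.carrier → Y, Function.extend Subtype.val u 0 z = u ⟨z, h⟩ := fun u =>
      Subtype.val_injective.extend_apply u 0 ⟨z, h⟩
    simp only [e, Pi.add_apply]
  · have : ¬ ∃ a : F.carrier, (a : E) = z := by
      rintro ⟨a, rfl⟩
      exact h a.2
    simp [Function.extend_apply' _ _ _ this]

variable {Y : Type*} [NormedAddCommGroup Y] [NormedSpace ℝ Y]

/-- The function `y ↦ φ y • f (P y)` on `M`, where `f` is extended by `0`. -/
noncomputable def weightedCompFun (M F : Polytope E) (φ : E → ℝ) (P : E → E) (f : F.carrier → Y) :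
    M.carrier → Y :=
  fun y => φ y • Function.extend Subtype.val f 0 (P y)

theorem weightedCompFun_of_mem (M F : Polytope E) (φ : E → ℝ) (P : E → E) (f : F.carrier → Y)
    {y : M.carrier} (h : P y ∈ F.carrier) :
    M.weightedCompFun F φ P f y = φ y • f ⟨P y, h⟩ := by
  rw [weightedCompFun, ← Subtype.val_injective.extend_apply f 0 ⟨P y, h⟩]

theorem extend_zero_smul (F : Polytope E) (c : ℝ) (f : F.carrier → Y) (z : E) :
    Function.extend Subtype.val (c • f) 0 z = c • Function.extend Subtype.val f 0 z := by
  by_cases h : z ∈ F.carrier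
  · have e : ∀ u : F.carrier → Y, Function.extend Subtype.val u 0 z = u ⟨z, h⟩ := fun u =>
      Subtype.val_injective.extend_apply u 0 ⟨z, h⟩
    simp only [e, Pi.smul_apply]
  · have : ¬ ∃ a : F.carrier, (a : E) = z := by
      rintro ⟨a, rfl⟩
      exact h a.2
    simp [Function.extend_apply' _ _ _ this]

variable {M F : Polytope E} {φ : E → ℝ} {P : E → E} {W : Set E}

theorem transFun_weightedCompFun_eqOn (hW : ∀ y ∈ M.carrier, y ∈ W → P y ∈ F.carrier)
    (x : M.carrier) (z : F.carrier) {Q : M.dirSpace → F.dirSpace}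
    (hQ : ∀ v : M.dirSpace, P ((x : E) + (v : E)) ∈ F.carrier →
        (z : E) + (Q v : E) = P ((x : E) + (v : E))) (f : F.carrier → Y) :
    Set.EqOn (M.transFun (M.weightedCompFun F φ P f) x)
      (fun v => φ ((x : E) + (v : E)) • (F.transFun f z ∘ Q) v)
      (M.transSet x ∩ (fun v : M.dirSpace => (x : E) + (v : E)) ⁻¹' W) := by
  rintro v ⟨hv, hvW⟩
  have h := hW _ hv hvW
  rw [transFun_of_mem _ _ _ hv]
  simp only [weightedCompFun, Function.comp, transFun, hQ v h]

theorem mapsTo_lift (hW : ∀ y ∈ M.carrier, y ∈ W → P y ∈ F.carrier)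
    (x : M.carrier) (z : F.carrier) {Q : M.dirSpace → F.dirSpace}
    (hQ : ∀ v : M.dirSpace, P ((x : E) + (v : E)) ∈ F.carrier →
        (z : E) + (Q v : E) = P ((x : E) + (v : E))) :
    Set.MapsTo Q (M.transSet x ∩ (fun v : M.dirSpace => (x : E) + (v : E)) ⁻¹' W)
      (F.transSet z) := by
  rintro v ⟨hv, hvW⟩
  have h := hW _ hv hvW
  change (z : E) + (Q v : E) ∈ F.carrier
  rwa [hQ v h]

theorem transFun_weightedCompFun_eventuallyEq (x : M.carrier) (f : F.carrier → Y) {v : M.dirSpace}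
    (hv : (x : E) + (v : E) ∉ tsupport φ) :
    M.transFun (M.weightedCompFun F φ P f) x =ᶠ[nhds v] fun _ => 0 := by
  have hc : Continuous fun v : M.dirSpace => (x : E) + (v : E) := by fun_prop
  filter_upwards [hc.continuousAt.preimage_mem_nhds
    ((isClosed_tsupport φ).isOpen_compl.mem_nhds hv)] with w hw
  have h0 : φ ((x : E) + (w : E)) = 0 := image_eq_zero_of_notMem_tsupport hw
  by_cases hwM : w ∈ M.transSet x
  · rw [transFun_of_mem _ _ _ hwM]
    simp [weightedCompFun, h0]
  · have : ¬ ∃ a : M.carrier, (a : E) = (x : E) + (w : E) := by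
      rintro ⟨a, ha⟩
      exact hwM (by change (x : E) + (w : E) ∈ M.carrier; rw [← ha]; exact a.2)
    simp [transFun, Function.extend_apply' _ _ _ this]

variable [FiniteDimensional ℝ E]

/-- The map `v ↦ P (x + v) - z`, composed with a projection onto `E_F`. -/
theorem exists_contDiff_lift (M F : Polytope E) {P : E → E} (hP : ContDiff ℝ ∞ P) (x : M.carrier)
    (z : F.carrier) : ∃ Q : M.dirSpace → F.dirSpace, ContDiff ℝ ∞ Q ∧
      ∀ v : M.dirSpace, P ((x : E) + (v : E)) ∈ F.carrier →
        (z : E) + (Q v : E) = P ((x : E) + (v : E)) := by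
  -- The vector `P (x + v) - z` need not be in `E_F` for all `v`. Applying a projection gives a map
  -- into `E_F` that is smooth everywhere and unchanged where `P (x + v) ∈ F`.
  obtain ⟨pr, hpr⟩ := Submodule.ClosedComplemented.of_finiteDimensional (𝕜 := ℝ) F.dirSpace
  refine ⟨fun v => pr (P ((x : E) + (v : E)) - z), ?_, fun v hv => ?_⟩
  · exact pr.contDiff.comp ((hP.comp (contDiff_const.add M.dirSpace.subtypeL.contDiff)).sub
      contDiff_const)
  · have h := hpr ⟨P ((x : E) + (v : E)) - z, vsub_mem_vectorSpan ℝ hv z.2⟩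
    simp only at h
    simp [h]

theorem uniqueDiffOn_transSet_inter (M : Polytope E) (x : M.carrier) {U : Set M.dirSpace}
    (hU : IsOpen U) : UniqueDiffOn ℝ (M.transSet x ∩ U) :=
  (M.uniqueDiffOn_transSet x).inter hU

/-- Points of the closed support of `φ` lie in the open set `W`, where the function is a composition
of smooth maps; near all other points it is zero. The extension of `f` by zero is thus harmless. -/
theorem IsSmooth.weightedCompFun (hφ : ContDiff ℝ ∞ φ) (hP : ContDiff ℝ ∞ P) (hWo : IsOpen W)
    (hφW : tsupport φ ⊆ W) (hW : ∀ y ∈ M.carrier, y ∈ W → P y ∈ F.carrier) {f : F.carrier → Y}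
    (hf : F.IsSmooth f) : M.IsSmooth (M.weightedCompFun F φ P f) := by
  intro x v hv
  obtain ⟨z, hz⟩ := F.nonempty
  obtain ⟨Q, hQ, hQe⟩ := exists_contDiff_lift M F hP x ⟨z, hz⟩
  have hc : Continuous fun v : M.dirSpace => (x : E) + (v : E) := by fun_prop
  by_cases hvs : (x : E) + (v : E) ∈ tsupport φ
  · have hU := hWo.preimage hc
    have hvU : v ∈ (fun v : M.dirSpace => (x : E) + (v : E)) ⁻¹' W := hφW hvs
    refine (contDiffWithinAt_inter (hU.mem_nhds hvU)).1 ?_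
    refine ContDiffOn.contDiffWithinAt ?_ ⟨hv, hvU⟩
    refine ContDiffOn.congr ?_ (transFun_weightedCompFun_eqOn hW x ⟨z, hz⟩ hQe f)
    refine ContDiffOn.smul ?_ ((hf ⟨z, hz⟩).comp hQ.contDiffOn (mapsTo_lift hW x ⟨z, hz⟩ hQe))
    exact (hφ.comp (contDiff_const.add M.dirSpace.subtypeL.contDiff)).contDiffOn
  · exact ((contDiffAt_const (c := (0 : Y))).congr_of_eventuallyEq
      (transFun_weightedCompFun_eventuallyEq x f hvs)).contDiffWithinAt

theorem exists_norm_iteratedFDeriv_le {V Z : Type*} [NormedAddCommGroup V] [NormedSpace ℝ V]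
    [NormedAddCommGroup Z] [NormedSpace ℝ Z] {S : Set V} (hS : IsCompact S) {g : V → Z}
    (hg : ContDiff ℝ ∞ g) (k : ℕ) :
    ∃ D : ℝ, 1 ≤ D ∧ ∀ i ≤ k, ∀ v ∈ S, ‖iteratedFDeriv ℝ i g v‖ ≤ D := by
  have h : ∀ i : ℕ, ∃ D : ℝ, ∀ v ∈ S, ‖iteratedFDeriv ℝ i g v‖ ≤ D := fun i =>
    hS.exists_bound_of_continuousOn
      (hg.continuous_iteratedFDeriv (by exact_mod_cast le_top)).continuousOn
  choose D hD using h
  refine ⟨1 + ∑ i ∈ Finset.range (k + 1), |D i|,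
    le_add_of_nonneg_right (Finset.sum_nonneg fun _ _ => abs_nonneg _), fun i hi v hv => ?_⟩
  calc _ ≤ D i := hD i v hv
    _ ≤ |D i| := le_abs_self _
    _ ≤ ∑ i ∈ Finset.range (k + 1), |D i| :=
      Finset.single_le_sum (f := fun i => |D i|) (fun _ _ => abs_nonneg _)
        (Finset.mem_range_succ_iff.2 hi)
    _ ≤ _ := by linarith

theorem exists_norm_iterFDeriv_weightedCompFun_le (hφ : ContDiff ℝ ∞ φ) (hP : ContDiff ℝ ∞ P)
    (hWo : IsOpen W) (hφW : tsupport φ ⊆ W) (hW : ∀ y ∈ M.carrier, y ∈ W → P y ∈ F.carrier)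
    (k : ℕ) : ∃ K : ℝ, 0 ≤ K ∧ ∀ (f : F.SmoothMap Y) (C : ℝ), 0 ≤ C →
      (∀ j ≤ k, ∀ y, ‖F.iterFDeriv f j y‖ ≤ C) →
        ∀ x, ‖M.iterFDeriv (M.weightedCompFun F φ P f) k x‖ ≤ K * C := by
  obtain ⟨z, hz⟩ := F.nonempty
  obtain ⟨x₀, hx₀⟩ := M.nonempty
  set x₁ : M.carrier := ⟨x₀, hx₀⟩
  obtain ⟨Q, hQ, hQe⟩ := exists_contDiff_lift M F hP x₁ ⟨z, hz⟩
  have hc : Continuous fun v : M.dirSpace => (x₁ : E) + (v : E) := by fun_prop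
  have hφ' : ContDiff ℝ ∞ fun v : M.dirSpace => φ ((x₁ : E) + (v : E)) :=
    hφ.comp (contDiff_const.add M.dirSpace.subtypeL.contDiff)
  obtain ⟨D, hD1, hD⟩ := exists_norm_iteratedFDeriv_le (M.isCompact_transSet x₁) hQ k
  obtain ⟨A, hA1, hA⟩ := exists_norm_iteratedFDeriv_le (M.isCompact_transSet x₁) hφ' k
  -- Leibniz rule: `A` bounds the derivatives of the cutoff, while `(k - i)! * D ^ (k - i)` comes
  -- from the estimate for derivatives of a composition with `Q`.
  refine ⟨∑ i ∈ Finset.range (k + 1), (k.choose i : ℝ) * A * ((k - i).factorial * D ^ (k - i)),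
    Finset.sum_nonneg fun i _ => by positivity, fun f C hC hf x => ?_⟩
  set v : M.dirSpace := ⟨(x : E) - (x₁ : E), vsub_mem_vectorSpan ℝ x.2 x₁.2⟩ with hv
  have hxv : (x₁ : E) + (v : E) = x := by simp [hv]
  have hvS : v ∈ M.transSet x₁ := by simp [transSet, hxv]
  rw [M.iterFDeriv_eq _ k x₁ x, ← hv]
  by_cases hvs : (x₁ : E) + (v : E) ∈ tsupport φ
  · set U : Set M.dirSpace := (fun v : M.dirSpace => (x₁ : E) + (v : E)) ⁻¹' W with hU
    have hUo : IsOpen U := hWo.preimage hc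
    have hvU : v ∈ U := hφW hvs
    have hu := M.uniqueDiffOn_transSet_inter x₁ hUo
    have hvSU : v ∈ M.transSet x₁ ∩ U := ⟨hvS, hvU⟩
    have hm := mapsTo_lift hW x₁ ⟨z, hz⟩ hQe
    rw [← iteratedFDerivWithin_inter_open hUo hvU, iteratedFDerivWithin_congr
      (transFun_weightedCompFun_eqOn hW x₁ ⟨z, hz⟩ hQe f) hvSU]
    have hfz := f.isSmooth ⟨z, hz⟩
    refine (norm_iteratedFDerivWithin_smul_le (N := ∞) hφ'.contDiffOn
      (hfz.comp hQ.contDiffOn hm) hu hvSU (by exact_mod_cast le_top)).trans ?_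
    rw [Finset.sum_mul]
    refine Finset.sum_le_sum fun i hi => ?_
    have hik : i ≤ k := Finset.mem_range_succ_iff.1 hi
    have h1 : ‖iteratedFDerivWithin ℝ i (fun v : M.dirSpace => φ ((x₁ : E) + (v : E)))
        (M.transSet x₁ ∩ U) v‖ ≤ A := by
      rw [iteratedFDerivWithin_eq_iteratedFDeriv hu
        (hφ'.contDiffAt.of_le (by exact_mod_cast le_top)) hvSU]
      exact hA i hik v hvS
    have h2 : ‖iteratedFDerivWithin ℝ (k - i) (F.transFun f ⟨z, hz⟩ ∘ Q)
        (M.transSet x₁ ∩ U) v‖ ≤ (k - i).factorial * C * D ^ (k - i) := by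
      have hki : ((k - i : ℕ) : WithTop ℕ∞) ≤ ∞ := by
        generalize k - i = j
        exact_mod_cast le_top
      refine norm_iteratedFDerivWithin_comp_le (N := ∞) hfz hQ.contDiffOn
        hki (F.uniqueDiffOn_transSet _) hu hm hvSU (fun j hj => ?_)
        fun j hj1 hj => ?_
      · have h := hf j (hj.trans (Nat.sub_le _ _)) ⟨_, hm hvSU⟩
        rw [F.iterFDeriv_eq _ j ⟨z, hz⟩] at h
        convert h using 4
        simp
      · rw [iteratedFDerivWithin_eq_iteratedFDeriv hu
          (hQ.contDiffAt.of_le (by exact_mod_cast le_top)) hvSU]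
        -- The composition estimate asks for the bound `D ^ j`; this is why `D` was chosen to be at
        -- least `1`.
        exact (hD j (hj.trans (Nat.sub_le _ _)) v hvS).trans
          (le_self_pow₀ hD1 (by omega))
    calc _ ≤ (k.choose i : ℝ) * A * ((k - i).factorial * C * D ^ (k - i)) := by gcongr
      _ = _ := by ring
  · rw [((transFun_weightedCompFun_eventuallyEq x₁ f hvs).filter_mono
      nhdsWithin_le_nhds).iteratedFDerivWithin_eq
      (transFun_weightedCompFun_eventuallyEq x₁ f hvs).self_of_nhds]
    have hn : (0 : ℝ) ≤ (∑ i ∈ Finset.range (k + 1),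
        (k.choose i : ℝ) * A * ((k - i).factorial * D ^ (k - i))) * C :=
      mul_nonneg (Finset.sum_nonneg fun i _ => by positivity) hC
    refine ContinuousMultilinearMap.opNorm_le_bound hn fun m => ?_
    have h0 : iteratedFDerivWithin ℝ k (fun _ : M.dirSpace => (0 : Y)) (M.transSet x₁) v = 0 :=
      congrFun iteratedFDerivWithin_fun_zero v
    rw [h0, zero_apply, norm_zero]
    positivity

/-- The operator `f ↦ (y ↦ φ y • f (P y))` from `C^∞(F, Y)` to `C^∞(M, Y)`. -/
noncomputable def weightedComp (hφ : ContDiff ℝ ∞ φ) (hP : ContDiff ℝ ∞ P) (hWo : IsOpen W)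
    (hφW : tsupport φ ⊆ W) (hW : ∀ y ∈ M.carrier, y ∈ W → P y ∈ F.carrier) :
    F.SmoothMap Y →ₗ[ℝ] M.SmoothMap Y where
  toFun f := ⟨M.weightedCompFun F φ P f, f.isSmooth.weightedCompFun hφ hP hWo hφW hW⟩
  map_add' f g := Subtype.ext <| funext fun y => by
    change φ y • Function.extend Subtype.val (f.1 + g.1) 0 (P y) = _ • _ + _ • _
    rw [extend_zero_add, smul_add]
  map_smul' c f := Subtype.ext <| funext fun y => by
    change φ y • Function.extend Subtype.val (c • f.1) 0 (P y) = c • (_ • _)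
    rw [extend_zero_smul, smul_comm]

theorem continuous_weightedComp (hφ : ContDiff ℝ ∞ φ) (hP : ContDiff ℝ ∞ P) (hWo : IsOpen W)
    (hφW : tsupport φ ⊆ W) (hW : ∀ y ∈ M.carrier, y ∈ W → P y ∈ F.carrier) :
    Continuous (weightedComp (Y := Y) hφ hP hWo hφW hW) :=
  SmoothMap.continuous_of_bound _ fun k =>
    exists_norm_iterFDeriv_weightedCompFun_le hφ hP hWo hφW hW k

end WeightedComp

/-! ### Continuity of restriction and closedness of the compatibility conditions -/

section Restriction

variable {E : Type*} [NormedAddCommGroup E] [NormedSpace ℝ E] [FiniteDimensional ℝ E]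

theorem continuous_restrictStrat {M : Polytope E} {l : ℕ} (F : M.Face l) :
    Continuous (restrictStrat F) := by
  rw [Topology.IsInducing.subtypeVal.continuous_iff]
  -- Restriction is the weighted composition with `φ = 1` and `P = id`, the face taking the role of
  -- the domain of the new function.
  have h := (continuous_weightedComp (Y := E) (M := F.1) (F := M) (W := Set.univ)
    (contDiff_const (c := (1 : ℝ))) contDiff_id isOpen_univ (Set.subset_univ _)
    fun y hy _ => F.subset hy).comp (continuous_subtype_val (p := (· ∈ M.stratFields)))
  refine h.congr fun f => Subtype.ext <| funext fun y => ?_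
  refine (F.1.weightedCompFun_of_mem M (fun _ => 1) id f.1 (F.subset y.2)).trans ?_
  simp only [one_smul]
  rfl

theorem continuous_restrictFaces (M : Polytope E) (l : ℕ) : Continuous (M.restrictFaces l) :=
  Continuous.subtype_mk (continuous_pi fun F => continuous_restrictStrat F) _

theorem isClosed_compatFields (M : Polytope E) (l : ℕ) :
    IsClosed (M.compatFields l : Set ((F : M.Face l) → F.1.stratFields)) := by
  have : (M.compatFields l : Set ((F : M.Face l) → F.1.stratFields)) =
      ⋂ (F : M.Face l) (G : M.Face l) (x : E) (hF : x ∈ F.1.carrier) (hG : x ∈ G.1.carrier),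
        {f | (f F).1 ⟨x, hF⟩ = (f G).1 ⟨x, hG⟩} := by
    ext f
    simp only [Set.mem_iInter]
    exact Iff.rfl
  rw [this]
  have key : ∀ (F : M.Face l) (x : F.1.carrier), Continuous
      fun f : ((F : M.Face l) → F.1.stratFields) => (f F).1 x := fun F x =>
    (SmoothMap.continuous_eval x).comp (continuous_subtype_val.comp (continuous_apply F))
  exact isClosed_iInter fun F => isClosed_iInter fun G => isClosed_iInter fun x =>
    isClosed_iInter fun hF => isClosed_iInter fun hG => isClosed_eq (key F _) (key G _)

end Restriction

end Polytope

/-! ### Finitely generated cones are polyhedral -/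

section FourierMotzkin

variable {V : Type*} [AddCommGroup V] [Module ℝ V]

/-- Fourier-Motzkin elimination of `t`: functionals negative at `v` bound `t` from below, those
positive at `v` from above. A solution exists if and only if each lower bound, including `0`, is at
most each upper bound and the constraints without `t` hold. -/
theorem exists_nonneg_forall_sub_smul_iff (T : Finset (V →ₗ[ℝ] ℝ)) (v : V) :
    ∃ T' : Finset (V →ₗ[ℝ] ℝ), ∀ w, (∃ t : ℝ, 0 ≤ t ∧ ∀ f ∈ T, 0 ≤ f (w - t • v)) ↔
      ∀ f ∈ T', 0 ≤ f w := by
  classical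
  refine ⟨T.filter (fun f => 0 ≤ f v) ∪ ((T.filter fun f => 0 < f v) ×ˢ
    (T.filter fun f => f v < 0)).image fun p => p.1 v • p.2 - p.2 v • p.1, fun w => ⟨?_, fun h => ?_⟩⟩
  · rintro ⟨t, ht, h⟩ f hf
    simp only [map_sub, map_smul, smul_eq_mul] at h
    rcases Finset.mem_union.1 hf with hf | hf
    · rw [Finset.mem_filter] at hf
      have := h f hf.1
      have := mul_nonneg ht hf.2
      linarith
    · obtain ⟨⟨p, q⟩, hpq, rfl⟩ := Finset.mem_image.1 hf
      simp only [Finset.mem_product, Finset.mem_filter] at hpq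
      obtain ⟨⟨hp, hpv⟩, hq, hqv⟩ := hpq
      simp only [LinearMap.sub_apply, LinearMap.smul_apply, smul_eq_mul]
      nlinarith [h p hp, h q hq]
  · have h1 : ∀ f ∈ T, 0 ≤ f v → 0 ≤ f w := fun f hf hfv =>
      h f (Finset.mem_union_left _ (Finset.mem_filter.2 ⟨hf, hfv⟩))
    have h2 : ∀ p ∈ T, ∀ q ∈ T, 0 < p v → q v < 0 → 0 ≤ p v * q w - q v * p w :=
      fun p hp q hq hpv hqv => h (p v • q - q v • p) (Finset.mem_union_right _
        (Finset.mem_image.2 ⟨(p, q), by simp [hp, hq, hpv, hqv], rfl⟩))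
    -- The lower bounds on `t`; the largest of them is the witness.
    set S : Finset ℝ := insert 0 ((T.filter fun f => f v < 0).image fun q => q w / q v) with hS
    have hSne : S.Nonempty := Finset.insert_nonempty _ _
    refine ⟨S.max' hSne, S.le_max' 0 (Finset.mem_insert_self _ _), fun f hf => ?_⟩
    simp only [map_sub, map_smul, smul_eq_mul]
    rcases lt_or_ge (f v) 0 with hfv | hfv
    · have := S.le_max' (f w / f v) (Finset.mem_insert_of_mem
        (Finset.mem_image.2 ⟨f, Finset.mem_filter.2 ⟨hf, hfv⟩, rfl⟩))
      rw [div_le_iff_of_neg hfv] at this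
      linarith
    · rcases Finset.mem_insert.1 (S.max'_mem hSne) with ht | ht
      · rw [ht]
        simpa using h1 f hf hfv
      · obtain ⟨q, hq, hqt⟩ := Finset.mem_image.1 ht
        rw [Finset.mem_filter] at hq
        rw [← hqt]
        rcases hfv.eq_or_lt with h0 | hpos
        · rw [← h0, mul_zero, sub_zero]
          exact h1 f hf hfv
        · have := h2 f hf q hq.1 hpos hq.2
          have e : f w - q w / q v * f v = (f v * q w - q v * f w) / (-(q v)) := by
            have := hq.2.ne
            field_simp
            ring
          rw [e]
          exact div_nonneg this (by linarith [hq.2])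

/-- Adding a generator to a cone means eliminating its nonnegative coefficient. The zero cone is cut
out by the coordinates and their negatives. -/
theorem exists_finset_forall_nonneg_iff_mem_cone [FiniteDimensional ℝ V] {ι : Type*} (u : ι → V)
    (s : Finset ι) : ∃ T : Finset (V →ₗ[ℝ] ℝ), ∀ w,
      (∃ c : ι → ℝ, (∀ i ∈ s, 0 ≤ c i) ∧ ∑ i ∈ s, c i • u i = w) ↔ ∀ f ∈ T, 0 ≤ f w := by
  classical
  induction s using Finset.induction_on with
  | empty =>
    set b := Module.finBasis ℝ V
    refine ⟨Finset.univ.image b.coord ∪ Finset.univ.image fun i => -b.coord i, fun w => ?_⟩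
    simp only [Finset.notMem_empty, false_imp_iff, implies_true, Finset.sum_empty, true_and,
      exists_const]
    constructor
    · rintro rfl f -
      simp
    · intro h
      refine (b.ext_elem fun i => ?_).symm
      have h1 := h (b.coord i) (by simp)
      have h2 := h (-b.coord i) (by simp)
      simp only [LinearMap.neg_apply, Module.Basis.coord_apply] at h1 h2
      simp only [map_zero, Finsupp.coe_zero, Pi.zero_apply]
      linarith
  | insert j s hj ih =>
    obtain ⟨T, hT⟩ := ih
    obtain ⟨T', hT'⟩ := exists_nonneg_forall_sub_smul_iff T (u j)
    refine ⟨T', fun w => ?_⟩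
    rw [← hT']
    simp only [← hT]
    constructor
    · rintro ⟨c, hc, rfl⟩
      refine ⟨c j, hc j (Finset.mem_insert_self _ _), c,
        fun i hi => hc i (Finset.mem_insert_of_mem hi), ?_⟩
      rw [Finset.sum_insert hj]
      abel
    · rintro ⟨t, ht, c, hc, h⟩
      have hu : ∀ i ∈ s, Function.update c j t i = c i := fun i hi =>
        Function.update_of_ne (by rintro rfl; exact hj hi) _ _
      refine ⟨Function.update c j t, fun i hi => ?_, ?_⟩
      · rcases Finset.mem_insert.1 hi with rfl | hi
        · simpa
        · rw [hu i hi]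
          exact hc i hi
      · rw [Finset.sum_insert hj, Function.update_self,
          Finset.sum_congr rfl fun i hi => by rw [hu i hi], h]
        abel

end FourierMotzkin

/-! ### Affine inequalities describing a polytope -/

theorem AffineMap.apply_add {E : Type*} [AddCommGroup E] [Module ℝ E] (a : E →ᵃ[ℝ] ℝ) (p v : E) :
    a (p + v) = a p + a.linear v := by
  rw [add_comm p v, ← vadd_eq_add, a.map_vadd, vadd_eq_add, add_comm]

/-- A convex set on which finitely many affine functions are nonnegative has a point at which each
of these functions is positive, unless it vanishes on the set. -/
theorem Convex.exists_forall_pos {E : Type*} [AddCommGroup E] [Module ℝ E] {K : Set E}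
    (hK : Convex ℝ K) (hne : K.Nonempty) (T : Finset (E →ᵃ[ℝ] ℝ))
    (hT : ∀ a ∈ T, ∀ y ∈ K, 0 ≤ a y) :
    ∃ z ∈ K, ∀ a ∈ T, (∃ y ∈ K, 0 < a y) → 0 < a z := by
  classical
  induction T using Finset.induction_on with
  | empty =>
    obtain ⟨z, hz⟩ := hne
    exact ⟨z, hz, by simp⟩
  | insert a T ha ih =>
    obtain ⟨z, hz, h⟩ := ih fun b hb => hT b (Finset.mem_insert_of_mem hb)
    by_cases hy : ∃ y ∈ K, 0 < a y
    · obtain ⟨y, hy, hay⟩ := hy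
      have h12 : (1 / 2 : ℝ) + 1 / 2 = 1 := by norm_num
      -- At a midpoint, a nonnegative function is positive as soon as it is positive at one
      -- endpoint.
      refine ⟨(1 / 2 : ℝ) • z + (1 / 2 : ℝ) • y, hK hz hy (by norm_num) (by norm_num) h12,
        fun b hb hby => ?_⟩
      rw [Convex.combo_affine_apply h12, smul_eq_mul, smul_eq_mul]
      have h1 := hT b hb z hz
      have h2 := hT b hb y hy
      rcases Finset.mem_insert.1 hb with rfl | hb
      · linarith
      · have := h b hb hby
        linarith
    · refine ⟨z, hz, fun b hb hby => ?_⟩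
      rcases Finset.mem_insert.1 hb with rfl | hb
      · exact absurd hby hy
      · exact h b hb hby

namespace Polytope

variable {E : Type*} [NormedAddCommGroup E] [NormedSpace ℝ E]

/-- Homogenisation: `y` is in the convex hull of `s` if and only if `(y, 1)` is in the cone
generated by `s × {1}`. -/
theorem exists_finset_forall_nonneg_iff [FiniteDimensional ℝ E] (M : Polytope E) :
    ∃ T : Finset (E →ᵃ[ℝ] ℝ), ∀ y, y ∈ M.carrier ↔ ∀ a ∈ T, 0 ≤ a y := by
  classical
  obtain ⟨s, -, hs⟩ := M.exists_finset
  obtain ⟨T, hT⟩ := exists_finset_forall_nonneg_iff_mem_cone (fun y : E => (y, (1 : ℝ))) s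
  let i : E →ᵃ[ℝ] E × ℝ := (AffineMap.id ℝ E).prod (AffineMap.const ℝ E 1)
  refine ⟨T.image fun f => f.toAffineMap.comp i, fun y => ?_⟩
  have h := hT (y, 1)
  rw [Finset.forall_mem_image]
  refine Iff.trans ?_ h
  rw [hs, Finset.mem_convexHull']
  refine exists_congr fun c => and_congr Iff.rfl ?_
  simp [Prod.ext_iff, Prod.fst_sum, Prod.snd_sum, and_comm]

/-- `T` is an irredundant finite set of affine functions such that `M` is the set of those points
of `aff M` at which all of them are nonnegative. -/
structure IsReducedRep (M : Polytope E) (T : Finset (E →ᵃ[ℝ] ℝ)) : Prop where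
  mem_iff : ∀ y, y ∈ M.carrier ↔ y ∈ affineSpan ℝ M.carrier ∧ ∀ a ∈ T, 0 ≤ a y
  exists_pos : ∀ a ∈ T, ∃ y ∈ M.carrier, 0 < a y
  exists_neg : ∀ a ∈ T, ∃ y ∈ affineSpan ℝ M.carrier, a y < 0 ∧ ∀ b ∈ T, b ≠ a → 0 ≤ b y

/-- A system of least cardinality is irredundant. Functions that vanish on `M` vanish on its affine
hull and can be dropped beforehand. -/
theorem exists_isReducedRep [FiniteDimensional ℝ E] (M : Polytope E) :
    ∃ T : Finset (E →ᵃ[ℝ] ℝ), M.IsReducedRep T := by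
  classical
  obtain ⟨T₀, hT₀⟩ := M.exists_finset_forall_nonneg_iff
  have hne : {T : Finset (E →ᵃ[ℝ] ℝ) | (∀ y, y ∈ M.carrier ↔ y ∈ affineSpan ℝ M.carrier ∧
      ∀ a ∈ T, 0 ≤ a y) ∧ ∀ a ∈ T, ∃ y ∈ M.carrier, 0 < a y}.Nonempty := by
    refine ⟨T₀.filter fun a => ∃ y ∈ M.carrier, 0 < a y, fun y => ⟨fun hy => ?_, ?_⟩, fun a ha =>
      (Finset.mem_filter.1 ha).2⟩
    · exact ⟨subset_affineSpan ℝ _ hy, fun a ha =>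
        (hT₀ y).1 hy a (Finset.mem_of_mem_filter a ha)⟩
    · rintro ⟨hy, h⟩
      refine (hT₀ y).2 fun a ha => ?_
      by_cases hpos : ∃ z ∈ M.carrier, 0 < a z
      · exact h a (Finset.mem_filter.2 ⟨ha, hpos⟩)
      · push Not at hpos
        have h0 : Set.EqOn a (AffineMap.const ℝ E (0 : ℝ)) M.carrier := fun z hz =>
          le_antisymm (hpos z hz) ((hT₀ z).1 hz a ha)
        have : Set.EqOn a (AffineMap.const ℝ E (0 : ℝ)) (affineSpan ℝ M.carrier) :=
          AffineMap.eqOn_affineSpan h0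
        exact (this hy).ge
  obtain ⟨T, ⟨h1, h2⟩, hmin⟩ := WellFounded.has_min (measure Finset.card).wf _ hne
  refine ⟨T, h1, h2, fun a ha => ?_⟩
  by_contra! hcon
  refine hmin (T.erase a) ⟨fun y => ⟨fun hy => ?_, ?_⟩, fun b hb =>
    h2 b (Finset.mem_of_mem_erase hb)⟩ (Finset.card_erase_lt_of_mem ha)
  · exact ⟨((h1 y).1 hy).1, fun b hb => ((h1 y).1 hy).2 b (Finset.mem_of_mem_erase hb)⟩
  · rintro ⟨hy, h⟩
    refine (h1 y).2 ⟨hy, fun b hb => ?_⟩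
    by_cases hba : b = a
    · subst hba
      by_contra! hneg
      obtain ⟨c, hc, hcb, hlt⟩ := hcon y hy hneg
      exact absurd (h c (Finset.mem_erase.2 ⟨hcb, hc⟩)) (not_le.2 hlt)
    · exact h b (Finset.mem_erase.2 ⟨hba, hb⟩)

end Polytope

namespace Polytope

/-! ### Faces as zero sets of facet functions, and general position for simple polytopes -/

section Faces

variable {E : Type*} [NormedAddCommGroup E] [NormedSpace ℝ E] {M : Polytope E}

/-- The set of all points of `M` at which all functions in `A` vanish. -/
def zeroFace (M : Polytope E) (A : Finset (E →ᵃ[ℝ] ℝ)) : Set E :=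
  {y | y ∈ M.carrier ∧ ∀ a ∈ A, a y = 0}

/-- The subspace of `E_M` on which the linear parts of all functions in `A` vanish. -/
def zeroDir (M : Polytope E) (A : Finset (E →ᵃ[ℝ] ℝ)) : Submodule ℝ E :=
  M.dirSpace ⊓ ⨅ a ∈ A, LinearMap.ker a.linear

theorem mem_zeroDir {A : Finset (E →ᵃ[ℝ] ℝ)} {v : E} :
    v ∈ M.zeroDir A ↔ v ∈ M.dirSpace ∧ ∀ a ∈ A, a.linear v = 0 := by
  simp [zeroDir]

theorem zeroDir_anti {A B : Finset (E →ᵃ[ℝ] ℝ)} (h : A ⊆ B) : M.zeroDir B ≤ M.zeroDir A :=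
  fun _ hv => mem_zeroDir.2 ⟨(mem_zeroDir.1 hv).1, fun a ha => (mem_zeroDir.1 hv).2 a (h ha)⟩

open Classical in
/-- The functions in `T` which vanish at `x`. -/
noncomputable def active (T : Finset (E →ᵃ[ℝ] ℝ)) (x : E) : Finset (E →ᵃ[ℝ] ℝ) :=
  T.filter fun a => a x = 0

theorem mem_active {T : Finset (E →ᵃ[ℝ] ℝ)} {x : E} {a : E →ᵃ[ℝ] ℝ} :
    a ∈ active T x ↔ a ∈ T ∧ a x = 0 := by
  simp [active]

theorem active_subset (T : Finset (E →ᵃ[ℝ] ℝ)) (x : E) : active T x ⊆ T :=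
  fun _ ha => (mem_active.1 ha).1

variable {T : Finset (E →ᵃ[ℝ] ℝ)}

theorem mem_zeroFace_active {x : E} (hx : x ∈ M.carrier) : x ∈ M.zeroFace (active T x) :=
  ⟨hx, fun _ ha => (mem_active.1 ha).2⟩

theorem mem_affineSpan_add {p v : E} (hp : p ∈ M.carrier) (hv : v ∈ M.dirSpace) :
    p + v ∈ affineSpan ℝ M.carrier := by
  rw [add_comm]
  exact AffineSubspace.vadd_mem_of_mem_direction (by rwa [direction_affineSpan])
    (subset_affineSpan ℝ _ hp)

namespace IsReducedRep

variable (hT : M.IsReducedRep T)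

include hT

theorem nonneg {a : E →ᵃ[ℝ] ℝ} (ha : a ∈ T) {y : E} (hy : y ∈ M.carrier) : 0 ≤ a y :=
  ((hT.mem_iff y).1 hy).2 a ha

theorem pos_of_notMem_active {a : E →ᵃ[ℝ] ℝ} (ha : a ∈ T) {y : E} (hy : y ∈ M.carrier)
    (h : a ∉ active T y) : 0 < a y :=
  (hT.nonneg ha hy).lt_of_ne' fun h0 => h (mem_active.2 ⟨ha, h0⟩)

theorem isFace_zeroFace {A : Finset (E →ᵃ[ℝ] ℝ)} (hA : A ⊆ T) :
    IsFace M.carrier (M.zeroFace A) := by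
  refine ⟨⟨fun y hy => hy.1, ?_⟩, ?_⟩
  · rintro x hx y hy z hz ⟨s, t, hs, ht, hst, rfl⟩
    refine ⟨hx, fun a ha => ?_⟩
    have h := hz.2 a ha
    rw [Convex.combo_affine_apply hst, smul_eq_mul, smul_eq_mul] at h
    have h1 := hT.nonneg (hA ha) hx
    have h2 := mul_nonneg ht.le (hT.nonneg (hA ha) hy)
    nlinarith
  · intro x hx y hy s t hs ht hst
    refine ⟨M.convex hx.1 hy.1 hs ht hst, fun a ha => ?_⟩
    rw [Convex.combo_affine_apply hst, hx.2 a ha, hy.2 a ha]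
    simp

/-- Moving from a point of `M` in a direction which is tangent to all active facets, one stays in
`M` for a short time. -/
theorem exists_add_smul_mem {A : Finset (E →ᵃ[ℝ] ℝ)} {w v : E} (hw : w ∈ M.carrier)
    (hv : v ∈ M.dirSpace) (hA : ∀ a ∈ A, a w = 0) (hAv : ∀ a ∈ A, 0 ≤ a.linear v)
    (hpos : ∀ a ∈ T, a ∉ A → 0 < a w) :
    ∃ ε : ℝ, 0 < ε ∧ w + ε • v ∈ M.carrier ∧ ∀ a ∈ T, a ∉ A → 0 < a (w + ε • v) := by
  have h : ∀ᶠ ε : ℝ in nhdsWithin 0 (Set.Ioi 0), ∀ a ∈ T, a ∉ A → 0 < a (w + ε • v) := by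
    refine (Finset.eventually_all T).2 fun a ha => ?_
    by_cases haA : a ∈ A
    · simp [haA]
    have hc : Continuous fun ε : ℝ => a (w + ε • v) := by
      simp only [AffineMap.apply_add, map_smul, smul_eq_mul]
      fun_prop
    have : ∀ᶠ ε : ℝ in nhds 0, 0 < a (w + ε • v) :=
      hc.continuousAt.eventually_const_lt (by simpa using hpos a ha haA)
    exact (this.filter_mono nhdsWithin_le_nhds).mono fun ε hε _ => hε
  obtain ⟨ε, hε, hε0⟩ := (h.and self_mem_nhdsWithin).exists
  refine ⟨ε, hε0, (hT.mem_iff _).2 ⟨mem_affineSpan_add hw (M.dirSpace.smul_mem ε hv),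
    fun a ha => ?_⟩, hε⟩
  by_cases haA : a ∈ A
  · rw [AffineMap.apply_add, hA a haA, zero_add, map_smul, smul_eq_mul]
    exact mul_nonneg (le_of_lt hε0) (hAv a haA)
  · exact (hε a ha haA).le

/-- From the relatively interior point `w`, one can move a little in each direction of `zeroDir`
without leaving the face. -/
theorem vectorSpan_zeroFace {A : Finset (E →ᵃ[ℝ] ℝ)} {w : E} (hw : w ∈ M.zeroFace A)
    (hpos : ∀ a ∈ T, a ∉ A → 0 < a w) : vectorSpan ℝ (M.zeroFace A) = M.zeroDir A := by
  refine le_antisymm ?_ fun v hv => ?_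
  · rw [vectorSpan_def, Submodule.span_le]
    rintro - ⟨y, hy, z, hz, rfl⟩
    refine mem_zeroDir.2 ⟨vsub_mem_vectorSpan ℝ hy.1 hz.1, fun a ha => ?_⟩
    rw [AffineMap.linearMap_vsub, hy.2 a ha, hz.2 a ha, vsub_self]
  · obtain ⟨hvM, hv0⟩ := mem_zeroDir.1 hv
    obtain ⟨ε, hε, hmem, -⟩ := hT.exists_add_smul_mem hw.1 hvM hw.2
      (fun a ha => (hv0 a ha).ge) hpos
    have h : w + ε • v ∈ M.zeroFace A := ⟨hmem, fun a ha => by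
      rw [AffineMap.apply_add, hw.2 a ha, map_smul, hv0 a ha]; simp⟩
    have h1 := vsub_mem_vectorSpan ℝ h hw
    rw [vsub_eq_sub, add_sub_cancel_left] at h1
    exact (Submodule.smul_mem_iff _ hε.ne').1 h1

/-- The segment from `y` to `x` can be prolonged beyond `x` inside `M`, so extremality of `F` at `x`
forces `y ∈ F`. -/
theorem zeroFace_active_subset {x : E} {F : Set E} (hF : IsFace M.carrier F) (hx : x ∈ F) :
    M.zeroFace (active T x) ⊆ F := by
  intro y hy
  have hxM := hF.1.subset hx
  obtain ⟨ε, hε, hz, -⟩ := hT.exists_add_smul_mem (A := active T x) (w := x) (v := x - y) hxM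
    (vsub_mem_vectorSpan ℝ hxM hy.1) (fun a ha => (mem_active.1 ha).2)
    (fun a ha => by
      rw [← vsub_eq_sub, AffineMap.linearMap_vsub, (mem_active.1 ha).2, hy.2 a ha, vsub_self])
    fun a ha h => hT.pos_of_notMem_active ha hxM h
  refine hF.1.left_mem_of_mem_openSegment hy.1 hz hx
    ⟨ε / (1 + ε), 1 / (1 + ε), by positivity, by positivity, by field_simp; ring, ?_⟩
  have h : ε / (1 + ε) + (1 / (1 + ε)) * (1 + ε) - ε / (1 + ε) = 1 := by field_simp; ring
  calc (ε / (1 + ε)) • y + (1 / (1 + ε)) • (x + ε • (x - y))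
      = ((1 / (1 + ε)) * (1 + ε)) • x + (ε / (1 + ε) - (1 / (1 + ε)) * ε) • y := by module
    _ = x := by
      rw [one_div_mul_cancel (by positivity), one_div_mul_eq_div, sub_self]
      simp

theorem minFace_eq {x : E} (hx : x ∈ M.carrier) : M.minFace x = M.zeroFace (active T x) :=
  Set.Subset.antisymm
    (Set.sInter_subset_of_mem ⟨hT.isFace_zeroFace (active_subset T x), mem_zeroFace_active hx⟩)
    (Set.subset_sInter fun _ hF => hT.zeroFace_active_subset hF.1 hF.2)

theorem vectorSpan_zeroFace_active {x : E} (hx : x ∈ M.carrier) :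
    vectorSpan ℝ (M.zeroFace (active T x)) = M.zeroDir (active T x) :=
  hT.vectorSpan_zeroFace (mem_zeroFace_active hx)
    fun _ ha h => hT.pos_of_notMem_active ha hx h

theorem strataSpace_eq {x : E} (hx : x ∈ M.carrier) :
    M.strataSpace x = M.zeroDir (active T x) := by
  rw [strataSpace, hT.minFace_eq hx, hT.vectorSpan_zeroFace_active hx]

/-- Take `z ∈ F` where a function in `T` vanishes only if it vanishes on all of `F`. -/
theorem exists_eq_zeroFace_active {F : Set E} (hF : IsFace M.carrier F) (hne : F.Nonempty) :
    ∃ z ∈ F, F = M.zeroFace (active T z) := by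
  obtain ⟨z, hz, hpos⟩ := hF.2.exists_forall_pos hne T
    fun a ha y hy => hT.nonneg ha (hF.1.subset hy)
  refine ⟨z, hz, Set.Subset.antisymm (fun y hy => ⟨hF.1.subset hy, fun a ha => ?_⟩)
    (hT.zeroFace_active_subset hF hz)⟩
  obtain ⟨haT, haz⟩ := mem_active.1 ha
  by_contra hne
  exact (hpos a haT ⟨y, hy, (hT.nonneg haT (hF.1.subset hy)).lt_of_ne' hne⟩).ne' haz

/-- The segment from a point where all functions are positive to one where only `a` is negative
crosses `a = 0` in `M`. -/
theorem exists_facet_point {a : E →ᵃ[ℝ] ℝ} (ha : a ∈ T) :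
    ∃ w ∈ M.carrier, a w = 0 ∧ ∀ b ∈ T, b ≠ a → 0 < b w := by
  obtain ⟨z, hz, hpos⟩ := M.convex.exists_forall_pos M.nonempty T fun a ha y hy => hT.nonneg ha hy
  replace hpos : ∀ b ∈ T, 0 < b z := fun b hb => hpos b hb (hT.exists_pos b hb)
  obtain ⟨y, hy, hya, hyb⟩ := hT.exists_neg a ha
  have haz := hpos a ha
  have hd : 0 < a z - a y := by linarith
  have hst : -a y / (a z - a y) + a z / (a z - a y) = 1 := by field_simp; ring
  have hs : 0 < -a y / (a z - a y) := div_pos (by linarith) hd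
  have ht : 0 < a z / (a z - a y) := div_pos haz hd
  set w := (-a y / (a z - a y)) • z + (a z / (a z - a y)) • y with hw
  have h0 : a w = 0 := by
    rw [hw, Convex.combo_affine_apply hst, smul_eq_mul, smul_eq_mul]
    field_simp
    ring
  have hb : ∀ b ∈ T, b ≠ a → 0 < b w := fun b hb hba => by
    rw [hw, Convex.combo_affine_apply hst, smul_eq_mul, smul_eq_mul]
    have h1 := mul_pos hs (hpos b hb)
    have h2 := mul_nonneg ht.le (hyb b hb hba)
    linarith
  refine ⟨w, (hT.mem_iff w).2 ⟨?_, fun b hbT => ?_⟩, h0, hb⟩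
  · exact (affineSpan ℝ M.carrier).convex (subset_affineSpan ℝ _ hz) hy hs.le ht.le hst
  · by_cases hba : b = a
    · rw [hba, h0]
    · exact (hb b hbT hba).le

end IsReducedRep

/-- The linear parts of the functions in `A`, as a linear map on `E_M`. -/
def linearParts (M : Polytope E) (A : Finset (E →ᵃ[ℝ] ℝ)) : M.dirSpace →ₗ[ℝ] (A → ℝ) :=
  LinearMap.pi fun a => a.1.linear.comp M.dirSpace.subtype

theorem linearParts_apply (A : Finset (E →ᵃ[ℝ] ℝ)) (v : M.dirSpace) (a : A) :
    M.linearParts A v a = a.1.linear v := rfl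

theorem map_ker_linearParts (A : Finset (E →ᵃ[ℝ] ℝ)) :
    (LinearMap.ker (M.linearParts A)).map M.dirSpace.subtype = M.zeroDir A := by
  ext v
  simp only [Submodule.mem_map, LinearMap.mem_ker, mem_zeroDir]
  constructor
  · rintro ⟨u, hu, rfl⟩
    exact ⟨u.2, fun a ha => congrFun hu ⟨a, ha⟩⟩
  · rintro ⟨hv, h⟩
    exact ⟨⟨v, hv⟩, funext fun a => h a.1 a.2, rfl⟩

theorem surjective_linearParts_mono {A B : Finset (E →ᵃ[ℝ] ℝ)} (h : A ⊆ B)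
    (hB : Function.Surjective (M.linearParts B)) : Function.Surjective (M.linearParts A) := by
  classical
  intro g
  obtain ⟨v, hv⟩ := hB fun b => if hb : b.1 ∈ A then g ⟨b.1, hb⟩ else 0
  refine ⟨v, funext fun a => ?_⟩
  have := congrFun hv ⟨a.1, h a.2⟩
  rw [linearParts_apply] at this
  rw [linearParts_apply, this, dif_pos a.2]

variable [FiniteDimensional ℝ E]

theorem finrank_zeroDir_add_finrank_range (A : Finset (E →ᵃ[ℝ] ℝ)) :
    Module.finrank ℝ (M.zeroDir A) + Module.finrank ℝ (LinearMap.range (M.linearParts A))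
      = M.dim := by
  rw [← map_ker_linearParts, Submodule.finrank_map_subtype_eq, add_comm]
  exact LinearMap.finrank_range_add_finrank_ker _

theorem finrank_zeroDir_add_card {A : Finset (E →ᵃ[ℝ] ℝ)}
    (hA : Function.Surjective (M.linearParts A)) :
    Module.finrank ℝ (M.zeroDir A) + A.card = M.dim := by
  rw [← M.finrank_zeroDir_add_finrank_range A, LinearMap.range_eq_top.2 hA, finrank_top,
    Module.finrank_fintype_fun_eq_card, Fintype.card_coe]

namespace IsReducedRep

variable (hT : M.IsReducedRep T)

include hT

omit [FiniteDimensional ℝ E] in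
theorem surjective_linearParts_singleton {a : E →ᵃ[ℝ] ℝ} (ha : a ∈ T) :
    Function.Surjective (M.linearParts {a}) := by
  obtain ⟨w, hw, h0, -⟩ := hT.exists_facet_point ha
  obtain ⟨y, hy, hpos⟩ := hT.exists_pos a ha
  intro g
  refine ⟨(g ⟨a, by simp⟩ / a y) • ⟨y - w, vsub_mem_vectorSpan ℝ hy hw⟩, funext ?_⟩
  rintro ⟨b, hb⟩
  obtain rfl := Finset.mem_singleton.1 hb
  rw [linearParts_apply]
  simp only [Submodule.coe_smul, map_smul, smul_eq_mul]
  rw [← vsub_eq_sub, AffineMap.linearMap_vsub, h0, vsub_eq_sub, sub_zero,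
    div_mul_cancel₀ _ hpos.ne']

/-- At each point of a simple polytope, the active facets are in general position. -/
theorem surjective_linearParts (hM : M.IsSimple) {x : E} (hx : x ∈ M.carrier) :
    Function.Surjective (M.linearParts (active T x)) := by
  classical
  rcases (active T x).eq_empty_or_nonempty with he | ⟨a₀, ha₀⟩
  · rw [he]
    exact fun g => ⟨0, funext fun a => absurd a.2 (Finset.notMem_empty _)⟩
  obtain ⟨N, hN⟩ := M.exists_carrier_eq_of_isFace (hT.isFace_zeroFace (active_subset T x))
    ⟨x, mem_zeroFace_active hx⟩
  have hNdim : N.dim = Module.finrank ℝ (M.zeroDir (active T x)) := by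
    rw [dim, dirSpace, hN, hT.vectorSpan_zeroFace_active hx]
  have hsum := M.finrank_zeroDir_add_finrank_range (active T x)
  have hfacet : ∀ a ∈ T, Module.finrank ℝ (M.zeroDir {a}) + 1 = M.dim := fun a ha => by
    simpa using M.finrank_zeroDir_add_card (hT.surjective_linearParts_singleton ha)
  have hlt : N.dim < M.dim := by
    have h1 := hfacet a₀ (active_subset T x ha₀)
    have h2 := Submodule.finrank_mono (M.zeroDir_anti (Finset.singleton_subset_iff.2 ha₀))
    omega
  have hcard := hM N (hN ▸ hT.isFace_zeroFace (active_subset T x)) hlt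
  have hex : ∀ a ∈ T, ∃ G : Polytope E, G.carrier = M.zeroFace {a} := fun a ha => by
    obtain ⟨w, hw, h0, -⟩ := hT.exists_facet_point ha
    exact M.exists_carrier_eq_of_isFace (hT.isFace_zeroFace (Finset.singleton_subset_iff.2 ha))
      ⟨w, hw, by simpa using h0⟩
  have : Nonempty (Polytope E) := ⟨M⟩
  choose! G hG using hex
  -- Distinct active functions define distinct facets containing the face `N`, and simplicity says
  -- that there are only `M.dim - N.dim` of these. This codimension is the rank of the active linear
  -- parts, so the rank is full.
  have hle : ((active T x : Set (E →ᵃ[ℝ] ℝ))).encard ≤ ((M.dim - N.dim : ℕ) : ℕ∞) := by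
    rw [← hcard]
    refine Set.encard_le_encard_of_injOn (f := G) (fun a ha => ?_) fun a ha b hb hab => ?_
    · have haT := active_subset T x ha
      obtain ⟨w, hw, h0, hwpos⟩ := hT.exists_facet_point haT
      refine ⟨hG a haT ▸ hT.isFace_zeroFace (Finset.singleton_subset_iff.2 haT), ?_, ?_⟩
      · rw [dim, dirSpace, hG a haT, hT.vectorSpan_zeroFace (w := w) ⟨hw, by simpa using h0⟩
          (by simpa using hwpos)]
        exact hfacet a haT
      · rw [hN, hG a haT]
        exact fun y hy => ⟨hy.1, fun b hb => hy.2 b (Finset.mem_singleton.1 hb ▸ ha)⟩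
    · have haT := active_subset T x ha
      have hbT := active_subset T x hb
      obtain ⟨w, hw, h0, hwpos⟩ := hT.exists_facet_point haT
      by_contra hne
      have hwG : w ∈ (G a).carrier := by
        rw [hG a haT]
        exact ⟨hw, by simpa using h0⟩
      rw [hab, hG b hbT] at hwG
      exact (hwpos b hbT (Ne.symm hne)).ne' (hwG.2 b (Finset.mem_singleton_self b))
  rw [Set.encard_coe_eq_coe_finsetCard, Nat.cast_le] at hle
  have hr : Module.finrank ℝ (LinearMap.range (M.linearParts (active T x)))
      ≤ (active T x).card := by
    simpa using Submodule.finrank_le (LinearMap.range (M.linearParts (active T x)))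
  refine LinearMap.range_eq_top.1 (Submodule.eq_top_of_finrank_eq ?_)
  rw [Module.finrank_fintype_fun_eq_card, Fintype.card_coe]
  omega

theorem finrank_zeroDir_active (hM : M.IsSimple) {x : E} (hx : x ∈ M.carrier)
    {A : Finset (E →ᵃ[ℝ] ℝ)} (hA : A ⊆ active T x) :
    Module.finrank ℝ (M.zeroDir A) + A.card = M.dim :=
  finrank_zeroDir_add_card (surjective_linearParts_mono hA (hT.surjective_linearParts hM hx))

/-- Each face of a simple polytope is given by as many facets as its codimension. -/
theorem exists_zeroFace_eq (hM : M.IsSimple) {l : ℕ} (F : M.Face l) :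
    ∃ A ⊆ T, F.1.carrier = M.zeroFace A ∧ l + A.card = M.dim := by
  obtain ⟨z, hz, h⟩ := hT.exists_eq_zeroFace_active F.2.1 F.1.nonempty
  refine ⟨_, active_subset T z, h, ?_⟩
  have hzM := F.subset hz
  rw [← hT.finrank_zeroDir_active hM hzM subset_rfl, ← F.2.2, dim, dirSpace, h,
    hT.vectorSpan_zeroFace_active hzM]

/-- Any subset `A` of the set of active facets defines a face of codimension `A.card`. -/
theorem exists_face (hM : M.IsSimple) {x : E} (hx : x ∈ M.carrier) {l : ℕ}
    {A : Finset (E →ᵃ[ℝ] ℝ)} (hA : A ⊆ active T x) (hl : l + A.card = M.dim) :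
    ∃ F : M.Face l, F.1.carrier = M.zeroFace A := by
  classical
  have hAT := hA.trans (active_subset T x)
  -- Moving along `v` keeps the functions in `A` at zero and makes the other active ones positive,
  -- which leads to a relatively interior point of the face.
  obtain ⟨v, hv⟩ := hT.surjective_linearParts hM hx fun a => if a.1 ∈ A then 0 else 1
  have hva : ∀ a ∈ active T x, a.linear v = if a ∈ A then 0 else 1 := fun a ha =>
    congrFun hv ⟨a, ha⟩
  obtain ⟨ε, hε, hmem, hpos⟩ := hT.exists_add_smul_mem (A := active T x) hx v.2
    (fun a ha => (mem_active.1 ha).2) (fun a ha => by rw [hva a ha]; split_ifs <;> simp)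
    fun a ha h => hT.pos_of_notMem_active ha hx h
  have hval : ∀ a ∈ active T x, a (x + ε • (v : E)) = if a ∈ A then 0 else ε := fun a ha => by
    rw [AffineMap.apply_add, (mem_active.1 ha).2, map_smul, hva a ha]
    simp
  have hw : x + ε • (v : E) ∈ M.zeroFace A := ⟨hmem, fun a ha => by simp [hval a (hA ha), ha]⟩
  have hwpos : ∀ a ∈ T, a ∉ A → 0 < a (x + ε • (v : E)) := fun a ha haA => by
    by_cases hax : a ∈ active T x
    · simp [hval a hax, haA, hε]
    · exact hpos a ha hax
  obtain ⟨N, hN⟩ := M.exists_carrier_eq_of_isFace (hT.isFace_zeroFace hAT) ⟨_, hw⟩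
  refine ⟨⟨N, hN ▸ hT.isFace_zeroFace hAT, ?_⟩, hN⟩
  have := hT.finrank_zeroDir_active hM hx hA
  rw [dim, dirSpace, hN, hT.vectorSpan_zeroFace hw hwpos]
  omega

end IsReducedRep

end Faces

end Polytope

/-! ### Inclusion-exclusion -/

theorem Finset.sum_nonempty_powerset_neg_one_pow {α Y : Type*} [DecidableEq α] [AddCommGroup Y]
    [Module ℝ Y] {K : Finset α} {a : α} (ha : a ∈ K) (u : Finset α → Y)
    (hu : ∀ S ⊆ K, S.Nonempty → a ∉ S → u (insert a S) = u S) :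
    ∑ S ∈ K.powerset.erase ∅, ((-1 : ℝ) ^ (S.card + 1)) • u S = u {a} := by
  -- The value `0` at `∅` allows pairing `S` with `insert a S` over the full power set. Non-empty
  -- pairs cancel, and the partner `{a}` of `∅` survives.
  set g : Finset α → Y := fun S => if S = ∅ then 0 else ((-1 : ℝ) ^ (S.card + 1)) • u S with hg
  have h1 : ∑ S ∈ K.powerset.erase ∅, ((-1 : ℝ) ^ (S.card + 1)) • u S
      = ∑ S ∈ K.powerset, g S := by
    rw [← Finset.add_sum_erase _ _ (Finset.empty_mem_powerset K)]
    simp only [hg, if_true, zero_add]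
    exact Finset.sum_congr rfl fun S hS => by rw [if_neg (Finset.ne_of_mem_erase hS)]
  rw [h1, ← Finset.insert_erase ha, Finset.sum_powerset_insert (Finset.notMem_erase a K),
    ← Finset.sum_add_distrib, Finset.sum_eq_single ∅]
  · simp [hg]
  · intro S hS hne
    have hSK := Finset.mem_powerset.1 hS
    have haS : a ∉ S := fun h => Finset.notMem_erase a K (hSK h)
    simp only [hg, if_neg hne, if_neg (Finset.insert_ne_empty a S), Finset.card_insert_of_notMem haS,
      hu S (hSK.trans (Finset.erase_subset a K)) (Finset.nonempty_iff_ne_empty.2 hne) haS]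
    rw [← add_smul, pow_succ _ (S.card + 1)]
    simp
  · simp

namespace Polytope

/-! ### Projections onto faces near a point -/

section Charts

variable {E : Type*} [NormedAddCommGroup E] [NormedSpace ℝ E] {M : Polytope E}
variable {T : Finset (E →ᵃ[ℝ] ℝ)}

theorem strataSpace_le_of_isFace {F : Polytope E} (hF : IsFace M.carrier F.carrier) {z : E}
    (hz : z ∈ F.carrier) : F.strataSpace z ≤ M.strataSpace z := by
  refine vectorSpan_mono ℝ fun y hy G hG => ?_
  refine (hy (F.carrier ∩ G) ⟨⟨?_, F.convex.inter hG.1.2⟩, hz, hG.2⟩).2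
  exact (hF.1.inter hG.1.1).mono hF.1.subset Set.inter_subset_left

/-- The projection `y ↦ y - ∑ a ∈ J, a y • e a`. -/
noncomputable def facetProj (e : (E →ᵃ[ℝ] ℝ) → E) (J : Finset (E →ᵃ[ℝ] ℝ)) (y : E) : E :=
  y - ∑ a ∈ J, a y • e a

variable {e : (E →ᵃ[ℝ] ℝ) → E} {J A : Finset (E →ᵃ[ℝ] ℝ)}

theorem facetProj_eq_self {y : E} (h : ∀ a ∈ J, a y = 0) : facetProj e J y = y := by
  rw [facetProj, Finset.sum_eq_zero fun a ha => by rw [h a ha, zero_smul], sub_zero]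

open Classical in
theorem facetProj_union {y : E} (h : ∀ a ∈ A, a y = 0) :
    facetProj e (A ∪ J) y = facetProj e J y := by
  rw [facetProj, facetProj, ← Finset.sum_subset Finset.subset_union_right fun a ha haJ => by
    rw [h a ((Finset.mem_union.1 ha).resolve_right haJ), zero_smul]]

theorem apply_facetProj (e : (E →ᵃ[ℝ] ℝ) → E) (J : Finset (E →ᵃ[ℝ] ℝ)) (b : E →ᵃ[ℝ] ℝ)
    (y : E) : b (facetProj e J y) = b y - ∑ a ∈ J, a y * b.linear (e a) := by
  rw [facetProj, sub_eq_add_neg, AffineMap.apply_add, map_neg, map_sum, ← sub_eq_add_neg]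
  simp

/-- `e` is a family of vectors of `E_M` dual to the linear parts of the functions in `A`. -/
def IsDualFamily (M : Polytope E) (A : Finset (E →ᵃ[ℝ] ℝ)) (e : (E →ᵃ[ℝ] ℝ) → E) : Prop :=
  (∀ a ∈ A, e a ∈ M.dirSpace) ∧ ∀ a ∈ A, a.linear (e a) = 1 ∧ ∀ b ∈ A, b ≠ a → b.linear (e a) = 0

theorem exists_isDualFamily (hA : Function.Surjective (M.linearParts A)) :
    ∃ e, M.IsDualFamily A e := by
  classical
  choose v hv using fun a : E →ᵃ[ℝ] ℝ => hA fun b => if b.1 = a then 1 else 0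
  have h : ∀ a b, b ∈ A → b.linear (v a) = if b = a then 1 else 0 := fun a b hb =>
    congrFun (hv a) ⟨b, hb⟩
  exact ⟨fun a => v a, fun a _ => (v a).2, fun a ha => ⟨by simp [h a a ha],
    fun b hb hba => by simp [h a b hb, hba]⟩⟩

namespace IsDualFamily

variable (he : M.IsDualFamily A e) (hJ : J ⊆ A)

include he hJ

theorem apply_facetProj_of_mem {b : E →ᵃ[ℝ] ℝ} (hb : b ∈ J) (y : E) :
    b (facetProj e J y) = 0 := by
  rw [apply_facetProj, Finset.sum_eq_single_of_mem b hb fun a ha hab => by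
    rw [(he.2 a (hJ ha)).2 b (hJ hb) hab.symm, mul_zero], (he.2 b (hJ hb)).1, mul_one, sub_self]

theorem apply_facetProj_of_notMem {b : E →ᵃ[ℝ] ℝ} (hbA : b ∈ A) (hb : b ∉ J) (y : E) :
    b (facetProj e J y) = b y := by
  rw [apply_facetProj, Finset.sum_eq_zero fun a ha => by
    rw [(he.2 a (hJ ha)).2 b hbA (by rintro rfl; exact hb ha), mul_zero], sub_zero]

end IsDualFamily

/-- The set of all points `y` such that the functions in `T \ A` are positive at each projection
of `y` along facets in `A`. -/
def chartNhd (T A : Finset (E →ᵃ[ℝ] ℝ)) (e : (E →ᵃ[ℝ] ℝ) → E) : Set E :=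
  {y | ∀ J ⊆ A, ∀ b ∈ T, b ∉ A → 0 < b (facetProj e J y)}

/-- The projection kills the functions in `J`, does not change those in `A \ J`, and keeps the
remaining ones positive by the choice of `chartNhd`. -/
theorem IsReducedRep.facetProj_mem_zeroFace (hT : M.IsReducedRep T)
    (he : M.IsDualFamily A e) (hJ : J ⊆ A) {y : E} (hy : y ∈ M.carrier)
    (hyW : y ∈ chartNhd T A e) : facetProj e J y ∈ M.zeroFace J := by
  refine ⟨(hT.mem_iff _).2 ⟨?_, fun b hb => ?_⟩, fun b hb => he.apply_facetProj_of_mem hJ hb y⟩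
  · rw [facetProj, sub_eq_add_neg]
    exact mem_affineSpan_add hy (M.dirSpace.neg_mem (M.dirSpace.sum_mem fun a ha =>
      M.dirSpace.smul_mem _ (he.1 a (hJ ha))))
  · by_cases hbA : b ∈ A
    · by_cases hbJ : b ∈ J
      · rw [he.apply_facetProj_of_mem hJ hbJ]
      · rw [he.apply_facetProj_of_notMem hJ hbA hbJ]
        exact hT.nonneg hb hy
    · exact (hyW J hJ b hb hbA).le

theorem active_subset_of_mem_chartNhd {y : E} (hyW : y ∈ chartNhd T A e) : active T y ⊆ A := by
  intro b hb
  by_contra hbA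
  have h := hyW ∅ (Finset.empty_subset _) b (mem_active.1 hb).1 hbA
  rw [facetProj_eq_self (by simp), (mem_active.1 hb).2] at h
  exact lt_irrefl _ h

theorem IsDualFamily.active_subset_active_facetProj (he : M.IsDualFamily A e) (hJ : J ⊆ A)
    {y : E} (hyW : y ∈ chartNhd T A e) : active T y ⊆ active T (facetProj e J y) := by
  intro b hb
  refine mem_active.2 ⟨(mem_active.1 hb).1, ?_⟩
  by_cases hbJ : b ∈ J
  · exact he.apply_facetProj_of_mem hJ hbJ y
  · rw [he.apply_facetProj_of_notMem hJ (active_subset_of_mem_chartNhd hyW hb) hbJ,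
      (mem_active.1 hb).2]

theorem IsReducedRep.mem_chartNhd (hT : M.IsReducedRep T) {x : E} (hx : x ∈ M.carrier) :
    x ∈ chartNhd T (active T x) e := by
  intro J hJ b hb hbA
  rw [facetProj_eq_self fun a ha => (mem_active.1 (hJ ha)).2]
  exact hT.pos_of_notMem_active hb hx hbA

theorem SmoothMap.sum_apply {ι Y : Type*} [NormedAddCommGroup Y] [NormedSpace ℝ Y] (s : Finset ι)
    (g : ι → M.SmoothMap Y) (y : M.carrier) : (∑ i ∈ s, g i) y = ∑ i ∈ s, g i y :=
  map_sum (AddMonoidHom.mk' (fun f : M.SmoothMap Y => f y) fun _ _ => rfl) g s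

variable [FiniteDimensional ℝ E]

theorem _root_.AffineMap.contDiff_of_finiteDimensional (a : E →ᵃ[ℝ] ℝ) : ContDiff ℝ ∞ a := by
  have : (a : E → ℝ) = fun y => a 0 + LinearMap.toContinuousLinearMap a.linear y := by
    funext y
    have := a.apply_add 0 y
    rwa [zero_add] at this
  rw [this]
  exact contDiff_const.add (ContinuousLinearMap.contDiff _)

theorem contDiff_facetProj (e : (E →ᵃ[ℝ] ℝ) → E) (J : Finset (E →ᵃ[ℝ] ℝ)) :
    ContDiff ℝ ∞ (facetProj e J) :=
  contDiff_id.sub (ContDiff.sum fun a _ => a.contDiff_of_finiteDimensional.smul contDiff_const)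

theorem isOpen_chartNhd (T A : Finset (E →ᵃ[ℝ] ℝ)) (e : (E →ᵃ[ℝ] ℝ) → E) :
    IsOpen (chartNhd T A e) := by
  have : chartNhd T A e = ⋂ J ∈ A.powerset, ⋂ b ∈ T,
      {y | b ∉ A → 0 < b (facetProj e J y)} := by
    ext y
    simp [chartNhd]
  rw [this]
  refine isOpen_biInter_finset fun J _ => isOpen_biInter_finset fun b _ => ?_
  by_cases hb : b ∈ A
  · simp [hb]
  · simpa [hb] using isOpen_lt continuous_const
      (b.contDiff_of_finiteDimensional.continuous.comp (contDiff_facetProj e J).continuous)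

theorem exists_finite_partition_of_unity {S : Set E} (hS : IsCompact S) (W : E → Set E)
    (hWo : ∀ x ∈ S, IsOpen (W x)) (hW : ∀ x ∈ S, x ∈ W x) :
    ∃ (t : Finset S) (φ : t → E → ℝ), (∀ i, ContDiff ℝ ∞ (φ i)) ∧
      (∀ i, tsupport (φ i) ⊆ W i.1) ∧ ∀ y ∈ S, ∑ i, φ i y = 1 := by
  obtain ⟨t, ht⟩ := hS.elim_nhds_subcover' (fun x _ => W x) fun x hx => (hWo x hx).mem_nhds (hW x hx)
  obtain ⟨φ, hφ⟩ := SmoothPartitionOfUnity.exists_isSubordinate (modelWithCornersSelf ℝ E)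
    hS.isClosed (fun i : t => W i.1) (fun i => hWo _ i.1.2) (by
      intro y hy
      obtain ⟨i, hi, hyi⟩ := Set.mem_iUnion₂.1 (ht hy)
      exact Set.mem_iUnion.2 ⟨⟨i, hi⟩, hyi⟩)
  refine ⟨t, fun i => φ i, fun i => (φ i).contMDiff.contDiff, fun i => hφ i, fun y hy => ?_⟩
  rw [← finsum_eq_sum_of_fintype]
  exact φ.sum_eq_one hy

end Charts

/-! ### Local extension operators and gluing -/

section Extension

variable {E : Type*} [NormedAddCommGroup E] [NormedSpace ℝ E] [FiniteDimensional ℝ E]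
  {M : Polytope E} {T : Finset (E →ᵃ[ℝ] ℝ)} {e : (E →ᵃ[ℝ] ℝ) → E}

/-- A single term of the inclusion-exclusion sum. It is built from the face given by `I` alone,
hence continuous in `f`; compatibility allows evaluating it in any `l`-face containing the projected
point. -/
theorem IsReducedRep.exists_extension_of_projection (hT : M.IsReducedRep T) (hM : M.IsSimple)
    {x : E} (hx : x ∈ M.carrier) (he : M.IsDualFamily (active T x) e) {l : ℕ}
    {I J : Finset (E →ᵃ[ℝ] ℝ)} (hIJ : I ⊆ J) (hJ : J ⊆ active T x) (hI : l + I.card = M.dim)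
    {ψ : E → ℝ} (hψ : ContDiff ℝ ∞ ψ) (hψW : tsupport ψ ⊆ chartNhd T (active T x) e) :
    ∃ B : M.compatFields l →ₗ[ℝ] M.SmoothMap E, Continuous B ∧
      ∀ (f : M.compatFields l) (y : M.carrier), B f y ∈ M.strataSpace y ∧
        (ψ y = 0 → B f y = 0) ∧ ((y : E) ∈ chartNhd T (active T x) e →
          ∀ (G : M.Face l) (h : facetProj e J y ∈ G.1.carrier),
            B f y = ψ y • (f.1 G).1 ⟨facetProj e J y, h⟩) := by
  obtain ⟨F, hF⟩ := hT.exists_face hM hx (hIJ.trans hJ) hI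
  have hW : ∀ y ∈ M.carrier, y ∈ chartNhd T (active T x) e → facetProj e J y ∈ F.1.carrier := by
    intro y hy hyW
    have h := hT.facetProj_mem_zeroFace he hJ hy hyW
    rw [hF]
    exact ⟨h.1, fun a ha => h.2 a (hIJ ha)⟩
  have hB := continuous_weightedComp (Y := E) hψ (contDiff_facetProj e J) (isOpen_chartNhd _ _ _)
    hψW hW
  set B := weightedComp (Y := E) hψ (contDiff_facetProj e J) (isOpen_chartNhd _ _ _) hψW hW
  have h0 : ∀ (f : F.1.SmoothMap E) (y : M.carrier), ψ y = 0 → B f y = 0 := fun f y hy => by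
    change ψ y • _ = _
    rw [hy, zero_smul]
  have hval : ∀ (f : M.compatFields l) (y : M.carrier),
      (y : E) ∈ chartNhd T (active T x) e → ∀ (G : M.Face l) (h : facetProj e J y ∈ G.1.carrier),
        B (f.1 F).1 y = ψ y • (f.1 G).1 ⟨facetProj e J y, h⟩ := fun f y hy G h => by
    rw [← f.2 F G _ (hW y y.2 hy) h]
    exact weightedCompFun_of_mem M F.1 ψ _ _ (hW y y.2 hy)
  refine ⟨B.comp (F.1.stratFields.subtype.comp
    ((LinearMap.proj F).comp (M.compatFields l).subtype)), ?_, fun f y => ⟨?_, h0 _ y, hval f y⟩⟩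
  · exact hB.comp (continuous_subtype_val.comp
      ((continuous_apply F).comp continuous_subtype_val))
  · change B (f.1 F).1 y ∈ _
    by_cases hy : (y : E) ∈ tsupport ψ
    · have hyW := hψW hy
      rw [hval f y hyW F (hW y y.2 hyW), hT.strataSpace_eq y.2]
      refine Submodule.smul_mem _ _ (zeroDir_anti (he.active_subset_active_facetProj hJ hyW) ?_)
      have hz := hW y y.2 hyW
      rw [← hT.strataSpace_eq (F.subset hz)]
      exact strataSpace_le_of_isFace F.2.1 hz ((f.1 F).2 ⟨_, hz⟩)
    · rw [h0 _ y (image_eq_zero_of_notMem_tsupport hy)]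
      exact Submodule.zero_mem _

/-- Local extension of compatible stratified vector fields, multiplied with a cutoff function. -/
theorem IsReducedRep.exists_local_extension (hT : M.IsReducedRep T) (hM : M.IsSimple)
    {x : E} (hx : x ∈ M.carrier) (he : M.IsDualFamily (active T x) e) {l : ℕ} (hl : l ≤ M.dim)
    {φ : E → ℝ} (hφ : ContDiff ℝ ∞ φ) (hφW : tsupport φ ⊆ chartNhd T (active T x) e) :
    ∃ L : M.compatFields l →ₗ[ℝ] M.SmoothMap E, Continuous L ∧
      (∀ (f : M.compatFields l) (y : M.carrier), L f y ∈ M.strataSpace y) ∧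
        ∀ (f : M.compatFields l) (F : M.Face l) (y : F.1.carrier),
          L f (Set.inclusion F.subset y) = φ y • (f.1 F).1 y := by
  classical
  -- The sets of active functions that define `l`-faces.
  set K := (active T x).powersetCard (M.dim - l) with hK
  have hsub : ∀ S ⊆ K, S.biUnion id ⊆ active T x := fun S hS =>
    Finset.biUnion_subset.2 fun I hI => (Finset.mem_powersetCard.1 (hS hI)).1
  have hex : ∀ S ∈ K.powerset.erase ∅, ∃ B : M.compatFields l →ₗ[ℝ] M.SmoothMap E,
      Continuous B ∧ ∀ (f : M.compatFields l) (y : M.carrier), B f y ∈ M.strataSpace y ∧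
        ((-1) ^ (S.card + 1) * φ y = 0 → B f y = 0) ∧
          ((y : E) ∈ chartNhd T (active T x) e →
            ∀ (G : M.Face l) (h : facetProj e (S.biUnion id) y ∈ G.1.carrier),
              B f y = ((-1) ^ (S.card + 1) * φ y) •
                (f.1 G).1 ⟨facetProj e (S.biUnion id) y, h⟩) := by
    intro S hS
    rw [Finset.mem_erase, Finset.mem_powerset] at hS
    obtain ⟨I, hI⟩ := Finset.nonempty_iff_ne_empty.2 hS.1
    have hIc := (Finset.mem_powersetCard.1 (hS.2 hI)).2
    exact hT.exists_extension_of_projection hM hx he (I := I) (Finset.subset_biUnion_of_mem id hI)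
      (hsub S hS.2) (by omega) (ψ := fun y => (-1) ^ (S.card + 1) * φ y) (contDiff_const.mul hφ)
      ((tsupport_mul_subset_right (f := fun _ => (-1 : ℝ) ^ (S.card + 1))).trans hφW)
  choose! B hBc hB using hex
  have happ : ∀ (f : M.compatFields l) (y : M.carrier),
      (∑ S ∈ K.powerset.erase ∅, B S) f y = ∑ S ∈ K.powerset.erase ∅, B S f y := fun f y => by
    rw [LinearMap.sum_apply, SmoothMap.sum_apply]
  refine ⟨∑ S ∈ K.powerset.erase ∅, B S, ?_, fun f y => ?_, fun f F y => ?_⟩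
  · have : (∑ S ∈ K.powerset.erase ∅, B S : M.compatFields l →ₗ[ℝ] M.SmoothMap E)
        = fun f => ∑ S ∈ K.powerset.erase ∅, B S f := by
      funext f
      rw [LinearMap.sum_apply]
    rw [this]
    exact continuous_finsetSum _ fun S hS => hBc S hS
  · rw [happ]
    exact Submodule.sum_mem _ fun S hS => (hB S hS f y).1
  · rw [happ]
    by_cases hy : (y : E) ∈ tsupport φ
    · have hyW := hφW hy
      obtain ⟨A, hAT, hFA, hAc⟩ := hT.exists_zeroFace_eq hM F
      have hyA : (y : E) ∈ M.zeroFace A := hFA ▸ y.2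
      have hyM : (y : E) ∈ M.carrier := hyA.1
      have hAx : A ⊆ active T x := fun a ha =>
        active_subset_of_mem_chartNhd hyW (mem_active.2 ⟨hAT ha, hyA.2 a ha⟩)
      have hAK : A ∈ K := Finset.mem_powersetCard.2 ⟨hAx, by omega⟩
      have hface : ∀ S ⊆ K, S.Nonempty →
          ∃ G : M.Face l, facetProj e (S.biUnion id) y ∈ G.1.carrier := by
        rintro S hS ⟨I, hI⟩
        have hIK := Finset.mem_powersetCard.1 (hS hI)
        obtain ⟨G, hG⟩ := hT.exists_face hM hx (l := l) hIK.1 (by omega)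
        have h := hT.facetProj_mem_zeroFace he (hsub S hS) hyM hyW
        refine ⟨G, ?_⟩
        rw [hG]
        exact ⟨h.1, fun a ha => h.2 a (Finset.mem_biUnion.2 ⟨I, hI, ha⟩)⟩
      have : Nonempty (M.Face l) := ⟨F⟩
      choose! G hG using hface
      -- The common value of the family at a point of the union of the `l`-faces, so that terms with
      -- different `S` can be compared without naming a face.
      let v : E → E := fun z => if h : ∃ G : M.Face l, z ∈ G.1.carrier then
        (f.1 h.choose).1 ⟨z, h.choose_spec⟩ else 0
      have hv : ∀ (z : E) (G : M.Face l) (h : z ∈ G.1.carrier), (f.1 G).1 ⟨z, h⟩ = v z := by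
        intro z G h
        have hz : ∃ G : M.Face l, z ∈ G.1.carrier := ⟨G, h⟩
        simp only [v, dif_pos hz]
        exact f.2 _ _ _ _ _
      have key := Finset.sum_nonempty_powerset_neg_one_pow hAK
        (fun S => φ y • v (facetProj e (S.biUnion id) y)) fun S _ _ _ => by
          -- All functions in `A` vanish at `y`, so adding `A` to `S` does not change the
          -- projection.
          rw [Finset.biUnion_insert, id, facetProj_union hyA.2]
      rw [Finset.singleton_biUnion, id, facetProj_eq_self hyA.2, ← hv y F y.2] at key
      rw [← key]
      refine Finset.sum_congr rfl fun S hS => ?_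
      have hS' := Finset.mem_erase.1 hS
      have hSK := Finset.mem_powerset.1 hS'.2
      have hSG := hG S hSK (Finset.nonempty_iff_ne_empty.2 hS'.1)
      rw [(hB S hS f (Set.inclusion F.subset y)).2.2 hyW (G S) hSG, ← hv _ (G S) hSG, mul_smul]
    · have h0 := image_eq_zero_of_notMem_tsupport hy
      rw [h0, zero_smul]
      exact Finset.sum_eq_zero fun S hS => (hB S hS f _).2.1 (by
        change _ * φ y = 0
        rw [h0, mul_zero])

theorem exists_continuous_extension (hM : M.IsSimple) {l : ℕ} (hl : l ≤ M.dim) :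
    ∃ τ : M.compatFields l →L[ℝ] M.stratFields, ∀ f : M.compatFields l,
      M.restrictFaces l (τ f) = f := by
  obtain ⟨T, hT⟩ := M.exists_isReducedRep
  choose! e he using fun x (hx : x ∈ M.carrier) =>
    exists_isDualFamily (hT.surjective_linearParts hM hx)
  obtain ⟨t, φ, hφ, hφW, hsum⟩ := exists_finite_partition_of_unity M.isCompact_carrier
    (fun x => chartNhd T (active T x) (e x)) (fun x _ => isOpen_chartNhd _ _ _)
    fun x hx => hT.mem_chartNhd hx
  choose L hLc hLs hL using fun i : t =>
    hT.exists_local_extension hM i.1.2 (he _ i.1.2) hl (hφ i) (hφW i)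
  have happ : ∀ (f : M.compatFields l) (y : M.carrier), (∑ i, L i) f y = ∑ i, L i f y :=
    fun f y => by rw [LinearMap.sum_apply, SmoothMap.sum_apply]
  have hc : Continuous (∑ i, L i : M.compatFields l →ₗ[ℝ] M.SmoothMap E) := by
    have : (∑ i, L i : M.compatFields l →ₗ[ℝ] M.SmoothMap E) = fun f => ∑ i, L i f := by
      funext f
      rw [LinearMap.sum_apply]
    rw [this]
    exact continuous_finsetSum _ fun i _ => hLc i
  refine ⟨⟨LinearMap.codRestrict M.stratFields (∑ i, L i) fun f y => ?_,
    Continuous.subtype_mk hc _⟩, fun f => ?_⟩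
  · rw [happ]
    exact Submodule.sum_mem _ fun i _ => hLs i f y
  · refine Subtype.ext <| funext fun F => Subtype.ext <| Subtype.ext <| funext fun y => ?_
    change (∑ i, L i) f (Set.inclusion F.subset y) = (f.1 F).1 y
    rw [happ, Finset.sum_congr rfl fun i _ => hL i f F y, ← Finset.sum_smul,
      hsum y (F.subset y.2), one_smul]

end Extension

end Polytope

theorem mainTheorem8 {E : Type*} [NormedAddCommGroup E] [NormedSpace ℝ E]
    [FiniteDimensional ℝ E] (n : ℕ) (hn : 1 ≤ n) (M : Polytope E) (hdim : M.dim = n)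
    (hM : M.IsSimple) (l : ℕ) (hl : 1 ≤ l) (hln : l + 1 ≤ n) :
    IsClosed (M.compatFields l : Set ((F : M.Face l) → F.1.stratFields)) ∧
      Continuous (M.restrictFaces l) ∧
      ∃ τ : M.compatFields l →L[ℝ] M.stratFields, ∀ f : M.compatFields l,
        M.restrictFaces l (τ f) = f :=
  ⟨M.isClosed_compatFields l, M.continuous_restrictFaces l,
    Polytope.exists_continuous_extension hM (by omega)⟩
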